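/- Let $d \ge 3$ be an integer, $q \ge 11$ a prime power, $G = SL_d(q)$ and $S = PSL_d(q) = G/\mathbf{Z}(G)$, and let $H \in \{G, S\}$. Set $e := \gcd(d, q-1)$ and $e_H := |\mathbf{Z}(H)|$; one has $e_G = e$ and $e_S = 1$. Let $\mathrm{Irr}(H)$ be the set of irreducible complex characters of $H$. Then the following hold. (i) $|\mathrm{Irr}(G)| \le q^{d-1} + 3q^{d-2} \le \tfrac{14}{11} q^{d-1}$ and $|\mathrm{Irr}(S)| \le \dfrac{q^{d-1} + 5q^{d-2}}{e} \le \dfrac{16}{11e} q^{d-1}$. Furthermore, $$\sum_{\chi \in \mathrm{Irr}(H),\ \chi(1) < q^{(d^2-d-1)/2}} \chi(1)^2 < \frac{5}{3q}\,|H|.$$ (ii) If $\chi \in \mathrm{Irr}(H)$ satisfies $\chi(1) \ge q^{(d^2-d-1)/2}$ and $x \in H \setminus \mathbf{Z}(H)$, then $$\frac{|\chi(x)|}{\chi(1)} \le q^{(3-d)/2}.$$ (iii) Suppose that $q = p^f$ is a power of a prime $p \ge d$. Then every $x \in H$ has order $\mathrm{ord}(x) < q^{d+1}$; furthermore, either $|\mathbf{C}_H(x)|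 \le q^{d^2-4d+8}$ or $\mathrm{ord}(x) < q^2$ (or both). (iv) There is an absolute constant $K$ with the following property. Suppose that $d \ge 43$, that $q = p$ is a prime with $p \ge d$, and that $p \ge K$ or $d \ge K$. Let $g \in H \setminus \{1\}$ have order $N$, and let $\Phi$ be a complex irreducible representation of $H$ of degree $\dim \Phi \ge q^{(d^2-d-1)/2}$. Then every eigenvalue of $\Phi(g)$ occurs with multiplicity at most $(e_H + 2)(\dim \Phi)/N$. -/

import Mathlib

/-- The set `Irr(H)` of irreducible complex characters of a group `H`: the traces of the
irreducible finite-dimensional complex representations (each of which is isomorphic to one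
acting on a coordinate space `ℂ^n`). -/
def IrrChar (H : Type*) [Group H] : Set (H → ℂ) :=
  {χ | ∃ (n : ℕ) (ρ : Representation ℂ H (Fin n → ℂ)),
    ρ.IsIrreducible ∧ χ = ρ.character}

/-- The degree `χ(1)` of a character, as a real number (it is the dimension of the
representation affording `χ`). -/
def charDegree {H : Type*} [Group H] (χ : H → ℂ) : ℝ := (χ 1).re

/-- For a character of a representation the degree is the dimension of the representation. -/
theorem charDegree_character {H : Type*} [Group H] {n : ℕ}
    (ρ : Representation ℂ H (Fin n → ℂ)) : charDegree ρ.character = n := by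
  simp [charDegree, Representation.character]

/-! ### Characters of finite groups: centralizer bound, class count, eigenvalue multiplicities -/

section Characters

open Representation
open scoped ComplexOrder

variable {H : Type*} [Group H] [Finite H]

/-! Everything reduces to three kinds of information about `SL_d(q)`: the number of conjugacy
classes, the sizes of centralizers and the orders of elements. Each passes to `PSL_d(q)` along a
surjection with central kernel, so most of the argument treats any such image `H` at once.

Class number. Irreducible characters are linearly independent class functions, so it suffices to
count classes. The primary decomposition of the module defined by a matrix is recorded by monic
polynomials `g_j`, where `g_j` is the product of the primes whose `(j+1)`-st power is an elementary
divisor. This type determines the `GL`-class (`Matrix.IsTypeOf.exists_conj`). A type contributes at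
most as many `SL`-classes as the index of the determinants of the centralizer
(`card_conjClasses_isTypeOf_le`), an index dividing every `j+1` with `g_j` nonconstant. For `PSL`
the scalars act on types by scaling roots, and a Burnside count (`card_conjClasses_mul_card_le`)
replaces the number of types by a sum over scalars of the fixed types; a type fixed by a scalar of
order `o` consists of polynomials in `X^o`, so nontrivial scalars contribute about `q^(d/2-1)` each.
What remains is a sum over partitions of `q` to the number of parts, dominated by geometric series
(`sum_shapes_dvd_le`). The bound on the sum of squared degrees follows, as each square is below
`q^(d^2-d-1)` and `|SL_d(q)|` is close to `q^(d^2-1)`.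

Character ratios. Orthogonality gives `|χ(x)|^2 ≤ |C(x)|`. A nonscalar matrix has commutant of
dimension at most `d^2-2d+2`; if some vector `v` has `v, xv, x^2v` independent, the dimension is at
most `d^2-4d+6`. If no such vector exists, a vector with maximal order ideal shows that `x`
satisfies a quadratic equation. Powers of `x` are nonzero elements of `F[x]`, so `x` has order below
`q^k` when it satisfies a monic equation of degree `k`.

Multiplicities. `N` times the multiplicity of an eigenvalue is at most the sum of `|χ(g^i)|` over a
period. Central powers contribute at most `e_H dim Φ`. The at most `q^4` powers of order below `q^2`
and the remaining powers, fewer than `q^d`, have such small ratios that each of these two groups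
adds at most `dim Φ` (`Representation.finrank_eigenspace_mul_orderOf_le`). -/

theorem Representation.character_inv_eq_star {V : Type*} [AddCommGroup V] [Module ℂ V]
    [FiniteDimensional ℂ V] (ρ : Representation ℂ H V) (g : H) :
    ρ.character g⁻¹ = star (ρ.character g) := by
  classical
  have := Fintype.ofFinite H
  let b := Module.finBasis ℂ V
  let M : H → Matrix _ _ ℂ := fun h => LinearMap.toMatrix b b (ρ h)
  have hM : ∀ h k, M (h * k) = M h * M k := fun h k => by
    simp only [M, map_mul]
    exact LinearMap.toMatrix_mul b _ _
  have hM1 : M 1 = 1 := by simp only [M, map_one]; exact LinearMap.toMatrix_one b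
  have htr : ∀ h, (M h).trace = ρ.character h := fun h =>
    (LinearMap.trace_eq_matrix_trace ℂ b (ρ h)).symm
  -- The averaged Hermitian form: its invariance makes `M g` similar to the conjugate transpose of
  -- `M g⁻¹`, so their traces agree.
  let A : Matrix _ _ ℂ := ∑ h, (M h).conjTranspose * M h
  have hA : A.PosDef := by
    have : A = (M 1).conjTranspose * M 1 +
        ∑ h ∈ Finset.univ.erase 1, (M h).conjTranspose * M h :=
      (Finset.add_sum_erase _ _ (Finset.mem_univ _)).symm
    rw [this, hM1]
    refine Matrix.PosDef.add_posSemidef (by simpa using Matrix.PosDef.one) ?_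
    exact Matrix.posSemidef_sum _ fun h _ => Matrix.posSemidef_conjTranspose_mul_self _
  have hcomm : A * M g = (M g⁻¹).conjTranspose * A := by
    simp only [A, Finset.sum_mul, Finset.mul_sum]
    refine Fintype.sum_equiv (Equiv.mulRight g) _ _ fun h => ?_
    simp only [Equiv.coe_mulRight]
    rw [← Matrix.mul_assoc, ← Matrix.conjTranspose_mul, ← hM, mul_inv_cancel_right, hM,
      Matrix.mul_assoc]
  have hdet : IsUnit A.det := (Matrix.isUnit_iff_isUnit_det _).1 hA.isUnit
  have : (M g⁻¹).conjTranspose = A * M g * A⁻¹ := by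
    rw [hcomm, Matrix.mul_assoc, Matrix.mul_nonsing_inv _ hdet, Matrix.mul_one]
  have h2 := congrArg Matrix.trace this
  rw [Matrix.trace_conjTranspose, Matrix.trace_mul_comm, ← Matrix.mul_assoc,
    Matrix.nonsing_inv_mul _ hdet, Matrix.one_mul, htr, htr] at h2
  rw [← h2, star_star]

theorem Representation.sum_norm_sq_character [Fintype H] {V : Type*} [AddCommGroup V] [Module ℂ V]
    [FiniteDimensional ℂ V] (ρ : Representation ℂ H V) [ρ.IsIrreducible] :
    ∑ h : H, ‖ρ.character h‖ ^ 2 = (Nat.card H : ℝ) := by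
  have hne : (Nat.card H : ℂ) ≠ 0 := Nat.cast_ne_zero.2 Nat.card_pos.ne'
  have := invertibleOfNonzero hne
  have h := char_orthonormal ρ ρ
  rw [if_pos ⟨Equiv.refl ρ⟩, inv_mul_eq_one₀ hne] at h
  have h2 : ∀ x, ρ.character x * ρ.character x⁻¹ = ((‖ρ.character x‖ ^ 2 : ℝ) : ℂ) := fun x => by
    rw [character_inv_eq_star, Complex.star_def, Complex.mul_conj, Complex.normSq_eq_norm_sq]
  simp_rw [h2] at h
  rw [← Complex.ofReal_sum] at h
  exact_mod_cast h.symm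

theorem card_conjClass_mul_card_centralizer (x : H) :
    Nat.card (ConjClasses.mk x).carrier * Nat.card (Subgroup.centralizer ({x} : Set H))
      = Nat.card H := by
  have := Fintype.ofFinite H
  have h1 := Subgroup.card_mul_index (MulAction.stabilizer (ConjAct H) x)
  rw [MulAction.index_stabilizer, ConjAct.orbit_eq_carrier_conjClasses,
    ← Nat.card_coe_set_eq] at h1
  rw [mul_comm, ← show Nat.card (ConjAct H) = Nat.card H from rfl, ← h1]
  congr 1
  rw [ConjAct.stabilizer_eq_centralizer]
  rfl

/-- The conjugacy class of `x` alone contributes `|class| * |χ(x)|^2` to the sum of `|χ|^2`, which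
is `|H|`. -/
theorem Representation.norm_sq_character_le_card_centralizer {V : Type*} [AddCommGroup V]
    [Module ℂ V] [FiniteDimensional ℂ V] (ρ : Representation ℂ H V) [ρ.IsIrreducible] (x : H) :
    ‖ρ.character x‖ ^ 2 ≤ (Nat.card (Subgroup.centralizer ({x} : Set H)) : ℝ) := by
  classical
  have := Fintype.ofFinite H
  have h1 := ρ.sum_norm_sq_character
  have h2 : ∑ h ∈ (ConjClasses.mk x).carrier.toFinset, ‖ρ.character h‖ ^ 2 ≤
      ∑ h : H, ‖ρ.character h‖ ^ 2 :=
    Finset.sum_le_sum_of_subset_of_nonneg (Finset.subset_univ _) fun _ _ _ => by positivity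
  rw [Finset.sum_congr rfl (g := fun _ => ‖ρ.character x‖ ^ 2), Finset.sum_const, h1,
    ← card_conjClass_mul_card_centralizer x, nsmul_eq_mul, Set.toFinset_card,
    ← Nat.card_eq_fintype_card, Nat.cast_mul] at h2
  · refine le_of_mul_le_mul_left h2 (Nat.cast_pos.2 ?_)
    rw [Nat.card_pos_iff]
    exact ⟨⟨x, ConjClasses.mem_carrier_mk⟩, inferInstance⟩
  · intro h hh
    rw [Set.mem_toFinset, ConjClasses.mem_carrier_iff_mk_eq, ConjClasses.mk_eq_mk_iff_isConj] at hh
    obtain ⟨c, hc⟩ := isConj_iff.1 hh.symm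
    rw [← hc, char_conj]

theorem linearIndependent_irrChar : LinearIndependent ℂ (fun χ : IrrChar H => (χ : H → ℂ)) := by
  classical
  have := Fintype.ofFinite H
  have hne : (Nat.card H : ℂ) ≠ 0 := Nat.cast_ne_zero.2 Nat.card_pos.ne'
  have := invertibleOfNonzero hne
  have key : ∀ χ ψ : IrrChar H, ∑ g, χ.1 g * ψ.1 g⁻¹ = if χ = ψ then (Nat.card H : ℂ) else 0 := by
    rintro ⟨χ, n, ρ, hρ, rfl⟩ ⟨ψ, m, σ, hσ, rfl⟩
    have h := char_orthonormal ρ σ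
    have h3 : ∀ c : ℂ, (Nat.card H : ℂ)⁻¹ * c = 0 → c = 0 := fun c hc => by
      simpa [hne] using hc
    split_ifs with he
    · change ∑ g, ρ.character g * σ.character g⁻¹ = _
      rw [← (Subtype.mk.inj he : ρ.character = σ.character)]
      have h' := char_orthonormal ρ ρ
      rw [if_pos ⟨Representation.Equiv.refl ρ⟩, inv_mul_eq_one₀ hne] at h'
      exact h'.symm
    · rw [if_neg] at h
      · exact h3 _ h
      · rintro ⟨φ⟩
        exact he (Subtype.ext (char_iso φ).symm)
  rw [linearIndependent_iff']
  intro s c hc ψ hψ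
  have h1 : ∑ g, (∑ χ ∈ s, c χ • χ.1) g * ψ.1 g⁻¹ = 0 := by rw [hc]; simp
  simp only [Finset.sum_apply, Pi.smul_apply, smul_eq_mul, Finset.sum_mul, mul_assoc] at h1
  rw [Finset.sum_comm] at h1
  simp_rw [← Finset.mul_sum, key] at h1
  simpa [hψ, hne] using h1

theorem irrChar_finite_and_ncard_le :
    (IrrChar H).Finite ∧ (IrrChar H).ncard ≤ Nat.card (ConjClasses H) := by
  have hcl : ∀ χ : IrrChar H, ∀ a b : H, IsConj a b → χ.1 a = χ.1 b := by
    rintro ⟨χ, n, ρ, hρ, rfl⟩ a b hab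
    obtain ⟨c, rfl⟩ := isConj_iff.1 hab
    exact (char_conj ρ a c).symm
  let f : IrrChar H → (ConjClasses H → ℂ) := fun χ c => χ.1 c.out
  let L : (ConjClasses H → ℂ) →ₗ[ℂ] (H → ℂ) := LinearMap.funLeft ℂ ℂ ConjClasses.mk
  have hf : ∀ χ, L (f χ) = χ.1 := by
    intro χ
    ext h
    refine hcl χ _ _ (ConjClasses.mk_eq_mk_iff_isConj.1 ?_)
    exact Quotient.out_eq _
  have hli : LinearIndependent ℂ f := by
    refine LinearIndependent.of_comp L ?_
    have : L ∘ f = fun χ : IrrChar H => (χ : H → ℂ) := funext hf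
    rw [this]
    exact linearIndependent_irrChar
  have := Fintype.ofFinite (ConjClasses H)
  have hfin : Finite (IrrChar H) := hli.finite
  have := Fintype.ofFinite (IrrChar H)
  refine ⟨Set.toFinite _, ?_⟩
  have := hli.fintype_card_le_finrank
  rwa [Module.finrank_fintype_fun_eq_card, ← Nat.card_eq_fintype_card, ← Nat.card_eq_fintype_card,
    Nat.card_coe_set_eq] at this

/-- The multiplicity of an eigenvalue of a group element is a Fourier coefficient of the
character restricted to the cyclic group generated by the element. -/
theorem Representation.finrank_eigenspace_eq {V : Type*} [AddCommGroup V] [Module ℂ V]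
    [FiniteDimensional ℂ V] (ρ : Representation ℂ H V) (g : H) (μ : ℂ)
    (hμ : Module.End.HasEigenvalue (ρ g) μ) :
    ‖μ‖ = 1 ∧ (Module.finrank ℂ (Module.End.eigenspace (ρ g) μ) : ℂ) =
      (orderOf g : ℂ)⁻¹ * ∑ i ∈ Finset.range (orderOf g), (μ⁻¹) ^ i * ρ.character (g ^ i) := by
  set N := orderOf g with hN
  have hNpos : 0 < N := orderOf_pos g
  have hN0 : (N : ℂ) ≠ 0 := Nat.cast_ne_zero.2 hNpos.ne'
  have hpow : ∀ (i : ℕ), ∀ v ∈ Module.End.eigenspace (ρ g) μ, (ρ (g ^ i)) v = μ ^ i • v := by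
    intro i v hv
    induction i with
    | zero => simp
    | succ i ih =>
      rw [pow_succ', map_mul, Module.End.mul_apply, ih, map_smul, Module.End.mem_eigenspace_iff.1 hv,
        smul_smul, pow_succ]
  obtain ⟨v, hv, hv0⟩ := hμ.exists_hasEigenvector
  have hμN : μ ^ N = 1 := by
    have := hpow N v hv
    rw [hN, pow_orderOf_eq_one, map_one, Module.End.one_apply] at this
    have h2 : (μ ^ N - 1) • v = 0 := by rw [sub_smul, one_smul, hN, ← this, sub_self]
    rcases smul_eq_zero.1 h2 with h | h
    · exact sub_eq_zero.1 h
    · exact absurd h hv0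
  have hμ0 : μ ≠ 0 := by
    rintro rfl
    rw [zero_pow hNpos.ne'] at hμN
    exact zero_ne_one hμN
  refine ⟨Complex.norm_eq_one_of_pow_eq_one hμN hNpos.ne', ?_⟩
  let P : V →ₗ[ℂ] V := (N : ℂ)⁻¹ • ∑ i ∈ Finset.range N, (μ⁻¹) ^ i • ρ (g ^ i)
  have hP : LinearMap.IsProj (Module.End.eigenspace (ρ g) μ) P := by
    constructor
    · intro w
      rw [Module.End.mem_eigenspace_iff]
      simp only [P, LinearMap.smul_apply, LinearMap.sum_apply, map_smul, map_sum]
      rw [smul_comm μ]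
      congr 1
      rw [Finset.smul_sum]
      have hstep : ∀ i, (μ⁻¹) ^ i • (ρ g) ((ρ (g ^ i)) w) =
          μ • ((μ⁻¹) ^ (i + 1) • (ρ (g ^ (i + 1))) w) := by
        intro i
        rw [smul_smul, pow_succ, mul_left_comm, mul_inv_cancel₀ hμ0, mul_one, pow_succ' g,
          map_mul, Module.End.mul_apply]
      simp_rw [hstep]
      rw [← Finset.smul_sum, ← Finset.smul_sum]
      congr 1
      -- Shifting the index replaces the term at `0` by the term at `N`; both equal `w`.
      have h1 := Finset.sum_range_succ' (fun i => (μ⁻¹) ^ i • (ρ (g ^ i)) w) N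
      rw [Finset.sum_range_succ] at h1
      rw [inv_pow, hμN, hN, pow_orderOf_eq_one] at h1
      simp only [pow_zero, inv_one] at h1
      exact (add_right_cancel h1).symm
    · intro w hw
      simp only [P, LinearMap.smul_apply, LinearMap.sum_apply]
      rw [Finset.sum_congr rfl (g := fun _ => w)]
      · rw [Finset.sum_const, Finset.card_range, ← Nat.cast_smul_eq_nsmul ℂ, smul_smul,
          inv_mul_cancel₀ hN0, one_smul]
      · intro i _
        rw [hpow i w hw, smul_smul, inv_pow, inv_mul_cancel₀ (pow_ne_zero _ hμ0), one_smul]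
  rw [← hP.trace]
  simp [P, Representation.character, map_sum]

end Characters

/-! ### Dimension bounds for the commutant of an endomorphism -/

section Commutant

variable {F V : Type*} [Field F] [AddCommGroup V] [Module F V]

/-- The map `Z ↦ XZ - ZX`. -/
def commutatorMap (X : V →ₗ[F] V) : (V →ₗ[F] V) →ₗ[F] (V →ₗ[F] V) :=
  LinearMap.mulLeft F X - LinearMap.mulRight F X

theorem commutatorMap_apply (X Z : V →ₗ[F] V) (v : V) :
    commutatorMap X Z v = X (Z v) - Z (X v) := rfl

theorem LinearIndependent.exists_dual_apply_eq {ι : Type*} {b : ι → V}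
    (hb : LinearIndependent F b) (c : ι → F) : ∃ φ : Module.Dual F V, ∀ i, φ (b i) = c i := by
  obtain ⟨φ, hφ⟩ := LinearMap.exists_extend ((Module.Basis.span hb).constr F c)
  refine ⟨φ, fun i => ?_⟩
  have h1 := LinearMap.congr_fun hφ (Module.Basis.span hb i)
  rw [Module.Basis.constr_basis, LinearMap.comp_apply, Submodule.subtype_apply,
    Module.Basis.span_apply] at h1
  exact h1

variable [FiniteDimensional F V]

/-- A test space `E` bounds the rank of `T` from below: `Ψ` embeds the kernel of `T ∘ L` in `C`, so
the rank is at least `dim E - dim C`. -/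
theorem finrank_ker_add_le_of_inf_ker_eq_bot {E A B C : Type*} [AddCommGroup E] [Module F E]
    [FiniteDimensional F E] [AddCommGroup A] [Module F A] [FiniteDimensional F A] [AddCommGroup B]
    [Module F B] [AddCommGroup C] [Module F C] [FiniteDimensional F C]
    (T : A →ₗ[F] B) (L : E →ₗ[F] A) (Ψ : E →ₗ[F] C)
    (h : ∀ e, T (L e) = 0 → Ψ e = 0 → e = 0) :
    Module.finrank F (LinearMap.ker T) + Module.finrank F E ≤
      Module.finrank F A + Module.finrank F C := by
  have h1 := LinearMap.finrank_range_add_finrank_ker T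
  have h2 := LinearMap.finrank_range_add_finrank_ker (T ∘ₗ L)
  have h3 : Module.finrank F (LinearMap.range (T ∘ₗ L)) ≤ Module.finrank F (LinearMap.range T) :=
    Submodule.finrank_mono (LinearMap.range_comp_le_range L T)
  have h4 : Module.finrank F (LinearMap.ker (T ∘ₗ L)) ≤ Module.finrank F C := by
    refine LinearMap.finrank_le_finrank_of_injective (f := Ψ ∘ₗ (LinearMap.ker (T ∘ₗ L)).subtype) ?_
    rw [← LinearMap.ker_eq_bot, LinearMap.ker_eq_bot']
    rintro ⟨e, he⟩ he2
    exact Subtype.ext (h e he he2)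
  omega

/-- Test maps are `φ ⊗ a + ψ ⊗ v`, with `φ` dual to `X v`. If `ψ` kills `v` and `X v` (two
conditions) and the map commutes with `X`, evaluation at `v` gives `a = 0`, and then applying `φ`
gives `ψ = 0`. -/
theorem finrank_ker_commutatorMap_le_of_linearIndependent_two (X : V →ₗ[F] V) (v : V)
    (hv : LinearIndependent F ![v, X v]) :
    Module.finrank F (LinearMap.ker (commutatorMap X)) + 2 * Module.finrank F V ≤
      Module.finrank F V ^ 2 + 2 := by
  obtain ⟨φ, h0, h1⟩ : ∃ φ : Module.Dual F V, φ v = 0 ∧ φ (X v) = 1 := by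
    obtain ⟨φ, hφ⟩ := hv.exists_dual_apply_eq ![0, 1]
    exact ⟨φ, hφ 0, hφ 1⟩
  let L : (V × Module.Dual F V) →ₗ[F] (V →ₗ[F] V) :=
    ((LinearMap.smulRightₗ φ).comp (LinearMap.fst F _ _)) +
      ((LinearMap.toSpanSingleton F V v).compRight F).comp (LinearMap.snd F _ _)
  have hL : ∀ a ψ w, L (a, ψ) w = φ w • a + ψ w • v := fun a ψ w => by
    simp [L]
  let Ψ : (V × Module.Dual F V) →ₗ[F] (F × F) :=
    ((LinearMap.applyₗ v).prod (LinearMap.applyₗ (X v))).comp (LinearMap.snd F _ _)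
  have key := finrank_ker_add_le_of_inf_ker_eq_bot (commutatorMap X) L Ψ ?_
  · simp only [Module.finrank_prod, Module.finrank_self, Subspace.dual_finrank_eq,
      Module.finrank_linearMap] at key
    rw [sq]
    omega
  · rintro ⟨a, ψ⟩ hT hΨ
    have hψ0 : ψ v = 0 := congrArg Prod.fst hΨ
    have hψ1 : ψ (X v) = 0 := congrArg Prod.snd hΨ
    have hT' : ∀ w, X (φ w • a + ψ w • v) - (φ (X w) • a + ψ (X w) • v) = 0 := fun w => by
      rw [← hL, ← hL, ← commutatorMap_apply, hT, LinearMap.zero_apply]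
    have ha : a = 0 := by simpa [h0, h1, hψ0, hψ1] using hT' v
    subst ha
    have : ψ = 0 := by
      ext w
      have := congrArg φ (hT' w)
      simpa [h0, h1] using this
    rw [this]; rfl

/-- The same argument with four free parameters `a, b, ψ, ξ`. The six conditions are the vanishing
of `ψ` and `ξ` on `v, X v, X² v`; evaluation at `v` and `X v` kills `b` and `a`, then `φ` and `φ ∘
X` kill `ξ` and `ψ`. -/
theorem finrank_ker_commutatorMap_le_of_linearIndependent_three (X : V →ₗ[F] V) (v : V)
    (hv : LinearIndependent F ![v, X v, X (X v)]) :
    Module.finrank F (LinearMap.ker (commutatorMap X)) + 4 * Module.finrank F V ≤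
      Module.finrank F V ^ 2 + 6 := by
  obtain ⟨φ, h0, h1, h2⟩ : ∃ φ : Module.Dual F V, φ v = 0 ∧ φ (X v) = 0 ∧ φ (X (X v)) = 1 := by
    obtain ⟨φ, hφ⟩ := hv.exists_dual_apply_eq ![0, 0, 1]
    exact ⟨φ, hφ 0, hφ 1, hφ 2⟩
  let R : V → (Module.Dual F V →ₗ[F] (V →ₗ[F] V)) := fun w =>
    (LinearMap.toSpanSingleton F V w).compRight F
  let L : ((V × V) × (Module.Dual F V × Module.Dual F V)) →ₗ[F] (V →ₗ[F] V) :=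
    ((LinearMap.smulRightₗ φ).coprod (LinearMap.smulRightₗ (φ ∘ₗ X))).coprod
      ((R v).coprod (R (X v)))
  have hL : ∀ a b ψ ξ w, L ((a, b), (ψ, ξ)) w =
      φ w • a + φ (X w) • b + (ψ w • v + ξ w • X v) := fun a b ψ ξ w => by
    simp [L, R]
  let E : Module.Dual F V →ₗ[F] (F × F × F) :=
    (LinearMap.applyₗ v).prod ((LinearMap.applyₗ (X v)).prod (LinearMap.applyₗ (X (X v))))
  let Ψ : ((V × V) × (Module.Dual F V × Module.Dual F V)) →ₗ[F] ((F × F × F) × (F × F × F)) :=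
    (E.prodMap E).comp (LinearMap.snd F _ _)
  have key := finrank_ker_add_le_of_inf_ker_eq_bot (commutatorMap X) L Ψ ?_
  · simp only [Module.finrank_prod, Module.finrank_self, Subspace.dual_finrank_eq,
      Module.finrank_linearMap] at key
    rw [sq]
    omega
  · rintro ⟨⟨a, b⟩, ⟨ψ, ξ⟩⟩ hT hΨ
    have hψ0 : ψ v = 0 := congrArg (fun t => t.1.1) hΨ
    have hψ1 : ψ (X v) = 0 := congrArg (fun t => t.1.2.1) hΨ
    have hψ2 : ψ (X (X v)) = 0 := congrArg (fun t => t.1.2.2) hΨ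
    have hξ0 : ξ v = 0 := congrArg (fun t => t.2.1) hΨ
    have hξ1 : ξ (X v) = 0 := congrArg (fun t => t.2.2.1) hΨ
    have hξ2 : ξ (X (X v)) = 0 := congrArg (fun t => t.2.2.2) hΨ
    have hT' : ∀ w, X (φ w • a + φ (X w) • b + (ψ w • v + ξ w • X v)) -
        (φ (X w) • a + φ (X (X w)) • b + (ψ (X w) • v + ξ (X w) • X v)) = 0 := fun w => by
      rw [← hL, ← hL, ← commutatorMap_apply, hT, LinearMap.zero_apply]
    have hb : b = 0 := by simpa [h0, h1, h2, hψ0, hψ1, hξ0, hξ1] using hT' v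
    subst hb
    have ha : a = 0 := by simpa [h0, h1, h2, hψ0, hψ1, hξ0, hξ1, hψ2, hξ2] using hT' (X v)
    subst ha
    have hξ : ξ = 0 := by
      ext w
      have := congrArg φ (hT' w)
      simpa [h0, h1, h2] using this
    subst hξ
    have hψ : ψ = 0 := by
      ext w
      have := congrArg (fun u => φ (X u)) (hT' w)
      simpa [h0, h1, h2] using this
    subst hψ
    rfl

theorem exists_linearIndependent_of_forall_ne_smul (X : V →ₗ[F] V)
    (hX : ∀ c : F, X ≠ c • LinearMap.id) : ∃ v, LinearIndependent F ![v, X v] := by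
  by_contra! h
  obtain ⟨a, ha⟩ := X.exists_eq_smul_id_of_forall_notLinearIndependent h
  exact hX a ha

end Commutant

/-! ### Primary decomposition of a matrix -/

section Types

open Polynomial Matrix

universe u

variable {F : Type u} [Field F] {d : ℕ}

/-- The structure theorem for torsion `F[X]`-modules, with primes made monic and the trivial factors
of exponent `0` discarded. -/
theorem Matrix.exists_primary_decomposition (x : Matrix (Fin d) (Fin d) F) :
    ∃ (ι : Type u) (_ : Fintype ι) (p : ι → F[X]) (e : ι → ℕ),
      (∀ i, (p i).Monic ∧ Irreducible (p i)) ∧ (∀ i, e i ≠ 0) ∧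
      ∃ φ : (Fin d → F) ≃ₗ[F] (Π i, AdjoinRoot (p i ^ e i)),
        ∀ v i, φ (x *ᵥ v) i = AdjoinRoot.root (p i ^ e i) * φ v i := by
  classical
  let M := Module.AEval' (Matrix.toLin' x)
  have htor : Module.IsTorsion F[X] M :=
    Module.AEval.isTorsion_of_finiteDimensional F (Fin d → F) (Matrix.toLin' x)
  obtain ⟨ι, hι, p, hp, e, ⟨N⟩⟩ := Module.equiv_directSum_of_isTorsion htor
  let P : ι → F[X] := fun i => normalize (p i)
  have hPp : ∀ i, Associated (p i ^ e i) (P i ^ e i) := fun i =>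
    (associated_normalize (p i)).pow_pow
  have hspan : ∀ i, (F[X] ∙ p i ^ e i) = Ideal.span {P i ^ e i} := fun i =>
    Ideal.span_singleton_eq_span_singleton.2 (hPp i)
  let T : Π i, (F[X] ⧸ (F[X] ∙ p i ^ e i)) ≃ₗ[F[X]] (F[X] ⧸ Ideal.span {P i ^ e i}) := fun i =>
    Submodule.quotEquivOfEq _ _ (hspan i)
  let G : M →ₗ[F[X]] (Π i : {i // e i ≠ 0}, F[X] ⧸ Ideal.span {P i.1 ^ e i.1}) :=
    LinearMap.pi fun i => (T i.1).toLinearMap ∘ₗ LinearMap.proj i.1 ∘ₗ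
      (DirectSum.linearEquivFunOnFintype F[X] ι _).toLinearMap ∘ₗ N.toLinearMap
  have hG : Function.Bijective G := by
    constructor
    · rw [← LinearMap.ker_eq_bot, LinearMap.ker_eq_bot']
      intro m hm
      apply N.injective
      apply (DirectSum.linearEquivFunOnFintype F[X] ι _).injective
      rw [map_zero, map_zero]
      ext i
      by_cases hi : e i = 0
      · have : Subsingleton (F[X] ⧸ (F[X] ∙ p i ^ e i)) := by
          rw [hi, pow_zero]
          exact Ideal.Quotient.subsingleton_iff.2 Ideal.span_singleton_one
        exact Subsingleton.elim _ _
      · have := congrFun hm ⟨i, hi⟩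
        exact (T i).map_eq_zero_iff.1 this
    · intro w
      let w' : Π i, (F[X] ⧸ (F[X] ∙ p i ^ e i)) := fun i =>
        if hi : e i ≠ 0 then (T i).symm (w ⟨i, hi⟩) else 0
      refine ⟨N.symm ((DirectSum.linearEquivFunOnFintype F[X] ι _).symm w'), ?_⟩
      ext i
      simp only [G, LinearMap.pi_apply, LinearMap.comp_apply, LinearEquiv.coe_coe,
        LinearEquiv.apply_symm_apply, LinearMap.proj_apply]
      simp [w', i.2]
  let G' := (LinearEquiv.ofBijective G hG).restrictScalars F
  refine ⟨{i // e i ≠ 0}, inferInstance, fun i => P i, fun i => e i, fun i => ⟨?_, ?_⟩, fun i => i.2,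
    (Module.AEval'.of (Matrix.toLin' x)).trans G', ?_⟩
  · exact Polynomial.monic_normalize (hp i).ne_zero
  · exact (associated_normalize (p i)).irreducible (hp i)
  · intro v i
    have h1 : Module.AEval'.of (Matrix.toLin' x) (x *ᵥ v) =
        (X : F[X]) • Module.AEval'.of (Matrix.toLin' x) v := by
      rw [Module.AEval'.X_smul_of, Matrix.toLin'_apply]
    change G (Module.AEval'.of (Matrix.toLin' x) (x *ᵥ v)) i = _ * G (Module.AEval'.of (Matrix.toLin' x) v) i
    rw [h1, map_smul, Pi.smul_apply]
    exact Algebra.smul_def (A := F[X] ⧸ Ideal.span {P i.1 ^ e i.1}) (X : F[X]) _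

theorem Matrix.aeval_apply_of_primary {ι : Type*} {Q : ι → F[X]} {x : Matrix (Fin d) (Fin d) F}
    (φ : (Fin d → F) ≃ₗ[F] (Π i, AdjoinRoot (Q i)))
    (hφ : ∀ v i, φ (x *ᵥ v) i = AdjoinRoot.root (Q i) * φ v i) (f : F[X]) (v : Fin d → F) (i : ι) :
    φ ((aeval x f) *ᵥ v) i = AdjoinRoot.mk (Q i) f * φ v i := by
  induction f using Polynomial.induction_on' with
  | add f g hf hg => simp [Matrix.add_mulVec, hf, hg, add_mul]
  | monomial n a =>
    rw [aeval_monomial, ← C_mul_X_pow_eq_monomial, map_mul, map_pow, AdjoinRoot.mk_X]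
    induction n generalizing v with
    | zero =>
      simp only [pow_zero, mul_one, Algebra.algebraMap_eq_smul_one, Matrix.smul_mulVec,
        Matrix.one_mulVec, map_smul, Pi.smul_apply]
      rw [Algebra.smul_def]
      rfl
    | succ n ih =>
      rw [pow_succ, ← mul_assoc, ← Matrix.mulVec_mulVec, ih, hφ]
      ring

/-- A matrix has a vector whose order ideal is the annihilator of the whole space. -/
theorem Matrix.exists_forall_aeval_mulVec_eq_zero (x : Matrix (Fin d) (Fin d) F) :
    ∃ v : Fin d → F, ∀ f : F[X], (aeval x f) *ᵥ v = 0 → aeval x f = 0 := by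
  obtain ⟨ι, _, p, e, -, -, φ, hφ⟩ := x.exists_primary_decomposition
  -- The generator of every cyclic factor at once: `f` annihilates it only if every `p i ^ e i`
  -- divides `f`.
  refine ⟨φ.symm 1, fun f hf => ?_⟩
  have h1 : ∀ i, AdjoinRoot.mk (p i ^ e i) f = 0 := fun i => by
    have := aeval_apply_of_primary φ hφ f (φ.symm 1) i
    rw [hf, map_zero, LinearEquiv.apply_symm_apply, Pi.one_apply, mul_one] at this
    exact this.symm
  apply Matrix.toLin'.injective
  refine LinearMap.ext fun w => φ.injective (funext fun i => ?_)
  rw [Matrix.toLin'_apply, aeval_apply_of_primary φ hφ, h1]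
  simp

end Types

/-! ### Element orders and centralizers in the special linear group -/

section SpecialLinear

open Polynomial Matrix

variable {F : Type*} [Field F] [Fintype F] {d : ℕ}

/-- Distinct powers of `x` give distinct remainders of `X ^ k` modulo `f`. The remainder `0` never
occurs, as powers of `x` are invertible, whence the strict inequality. -/
theorem Matrix.SpecialLinearGroup.orderOf_lt_of_aeval_eq_zero (hd : 0 < d)
    (x : SpecialLinearGroup (Fin d) F) (f : F[X]) (hf : f.Monic)
    (hx : aeval (x : Matrix (Fin d) (Fin d) F) f = 0) :
    orderOf x < Fintype.card F ^ f.natDegree := by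
  have : Nonempty (Fin d) := ⟨⟨0, hd⟩⟩
  have : Finite (SpecialLinearGroup (Fin d) F) := inferInstance
  have := Fintype.ofEquiv _ (degreeLTEquiv F f.natDegree).symm.toEquiv
  have hcard : Fintype.card (degreeLT F f.natDegree) = Fintype.card F ^ f.natDegree := by
    rw [Fintype.card_congr (degreeLTEquiv F f.natDegree).toEquiv]
    simp
  let r : Fin (orderOf x) → degreeLT F f.natDegree := fun k =>
    ⟨X ^ (k : ℕ) %ₘ f, by
      rw [mem_degreeLT, ← degree_eq_natDegree hf.ne_zero]
      exact degree_modByMonic_lt _ hf⟩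
  have hr : ∀ k, aeval (x : Matrix (Fin d) (Fin d) F) (r k).1 =
      ((x ^ (k : ℕ) : SpecialLinearGroup (Fin d) F) : Matrix (Fin d) (Fin d) F) := fun k => by
    have h := congrArg (aeval (x : Matrix (Fin d) (Fin d) F))
      (modByMonic_add_div (X ^ (k : ℕ)) f)
    rw [map_add, map_mul, hx, zero_mul, add_zero, map_pow, aeval_X] at h
    rw [h, SpecialLinearGroup.coe_pow]
  have hinj : Function.Injective r := fun a b hab => by
    have h := hr a
    rw [hab, hr b] at h
    have h2 := Subtype.val_injective h
    exact Fin.ext (pow_injOn_Iio_orderOf b.2 a.2 h2).symm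
  have hns : ¬ Function.Surjective r := fun hs => by
    obtain ⟨k, hk⟩ := hs 0
    have h := hr k
    rw [hk, ZeroMemClass.coe_zero, map_zero] at h
    have h2 := congrArg Matrix.det h
    rw [SpecialLinearGroup.det_coe, Matrix.det_zero] at h2
    exact zero_ne_one h2
  have := Fintype.card_lt_of_injective_not_surjective r hinj hns
  rwa [Fintype.card_fin, hcard] at this

theorem Matrix.SpecialLinearGroup.card_centralizer_le (x : SpecialLinearGroup (Fin d) F) :
    Nat.card (Subgroup.centralizer ({x} : Set (SpecialLinearGroup (Fin d) F))) ≤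
      Fintype.card F ^ Module.finrank F
        (LinearMap.ker (commutatorMap (Matrix.toLin' (x : Matrix (Fin d) (Fin d) F)))) := by
  classical
  have : Finite ((Fin d → F) →ₗ[F] (Fin d → F)) := Finite.of_equiv _ Matrix.toLin'.toEquiv
  have := Fintype.ofFinite
    (LinearMap.ker (commutatorMap (Matrix.toLin' (x : Matrix (Fin d) (Fin d) F))))
  refine le_trans ?_ (Module.card_eq_pow_finrank (K := F) (V := LinearMap.ker
    (commutatorMap (Matrix.toLin' (x : Matrix (Fin d) (Fin d) F))))).le
  rw [← Nat.card_eq_fintype_card]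
  refine Nat.card_le_card_of_injective (fun y => ⟨Matrix.toLin' (y.1 : Matrix _ _ F), ?_⟩) ?_
  · have h := Subgroup.mem_centralizer_singleton_iff.1 y.2
    have h2 := congrArg (fun z : SpecialLinearGroup (Fin d) F => Matrix.toLin' (z : Matrix (Fin d) (Fin d) F)) h
    simp only [SpecialLinearGroup.coe_mul, Matrix.toLin'_mul] at h2
    rw [LinearMap.mem_ker]
    refine LinearMap.ext fun w => ?_
    rw [commutatorMap_apply, LinearMap.zero_apply, sub_eq_zero]
    exact (LinearMap.congr_fun h2 w).symm
  · intro a b hab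
    exact Subtype.ext (Subtype.ext (Matrix.toLin'.injective (Subtype.mk.inj hab)))

theorem Matrix.SpecialLinearGroup.card_centralizer_le_of_notMem_center
    (x : SpecialLinearGroup (Fin d) F) (hx : x ∉ Subgroup.center (SpecialLinearGroup (Fin d) F)) :
    Nat.card (Subgroup.centralizer ({x} : Set (SpecialLinearGroup (Fin d) F))) ≤
      Fintype.card F ^ (d ^ 2 + 2 - 2 * d) := by
  have hne : ∀ c : F, Matrix.toLin' (x : Matrix (Fin d) (Fin d) F) ≠ c • LinearMap.id := by
    refine fun c hc => hx ?_
    have h : (x : Matrix (Fin d) (Fin d) F) = Matrix.scalar (Fin d) c := by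
      apply Matrix.toLin'.injective
      rw [hc, Matrix.scalar_apply, ← Matrix.smul_one_eq_diagonal, map_smul, Matrix.toLin'_one]
    rw [SpecialLinearGroup.mem_center_iff]
    refine ⟨c, ?_, h.symm⟩
    have h2 := x.det_coe
    rw [h] at h2
    simpa using h2
  obtain ⟨v, hv⟩ := exists_linearIndependent_of_forall_ne_smul _ hne
  refine (card_centralizer_le x).trans (Nat.pow_le_pow_right Fintype.card_pos ?_)
  have := finrank_ker_commutatorMap_le_of_linearIndependent_two _ v hv
  rw [Module.finrank_fin_fun] at this
  omega

theorem Matrix.SpecialLinearGroup.orderOf_lt (hd : 0 < d) (x : SpecialLinearGroup (Fin d) F) :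
    orderOf x < Fintype.card F ^ d := by
  have h := orderOf_lt_of_aeval_eq_zero hd x _
    (Matrix.charpoly_monic (x : Matrix (Fin d) (Fin d) F)) (Matrix.aeval_self_charpoly _)
  rwa [Matrix.charpoly_natDegree_eq_dim, Fintype.card_fin] at h

theorem Matrix.SpecialLinearGroup.card_centralizer_le_or_orderOf_lt (hd : 2 ≤ d)
    (x : SpecialLinearGroup (Fin d) F) :
    Nat.card (Subgroup.centralizer ({x} : Set (SpecialLinearGroup (Fin d) F))) ≤
      Fintype.card F ^ (d ^ 2 + 8 - 4 * d) ∨ orderOf x < Fintype.card F ^ 2 := by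
  obtain ⟨v, hv⟩ := (x : Matrix (Fin d) (Fin d) F).exists_forall_aeval_mulVec_eq_zero
  let A : Matrix (Fin d) (Fin d) F := x
  by_cases hli : LinearIndependent F ![v, Matrix.toLin' A v, Matrix.toLin' A (Matrix.toLin' A v)]
  · left
    refine (card_centralizer_le x).trans (Nat.pow_le_pow_right Fintype.card_pos ?_)
    have := finrank_ker_commutatorMap_le_of_linearIndependent_three _ v hli
    rw [Module.finrank_fin_fun] at this
    have h2 : 4 * d ≤ d ^ 2 + 4 := by nlinarith [sq_nonneg ((d : ℤ) - 2)]
    change Module.finrank F (LinearMap.ker (commutatorMap (Matrix.toLin' A))) ≤ _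
    omega
  · right
    rw [Fintype.not_linearIndependent_iff] at hli
    obtain ⟨c, hc, i, hi⟩ := hli
    rw [Fin.sum_univ_three] at hc
    -- The dependence relation at `v` is a polynomial of degree at most `2` killing `v`; by the
    -- choice of `v` it kills the whole space.
    let f : F[X] := C (c 2) * X ^ 2 + C (c 1) * X + C (c 0)
    have hf0 : f ≠ 0 := by
      intro h
      apply hi
      have h0 : f.coeff 0 = 0 := by rw [h]; simp
      have h1 : f.coeff 1 = 0 := by rw [h]; simp
      have h2 : f.coeff 2 = 0 := by rw [h]; simp
      simp [f, coeff_X, coeff_C] at h0 h1 h2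
      fin_cases i <;> assumption
    have hfd : f.natDegree ≤ 2 := natDegree_quadratic_le
    have hfx : aeval A f = 0 := by
      apply hv
      simp only [Matrix.cons_val_zero, Matrix.cons_val_one, Matrix.cons_val,
        Matrix.toLin'_apply] at hc
      simp only [f, map_add, map_mul, aeval_C, aeval_X, Matrix.add_mulVec,
        Algebra.algebraMap_eq_smul_one, smul_mul_assoc, one_mul, Matrix.smul_mulVec,
        Matrix.one_mulVec, pow_two, ← Matrix.mulVec_mulVec]
      rw [← hc]
      abel
    have h := orderOf_lt_of_aeval_eq_zero (by omega) x (f * C f.leadingCoeff⁻¹)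
      (monic_mul_leadingCoeff_inv hf0) (by rw [map_mul]; change aeval A f * _ = 0; rw [hfx, zero_mul])
    refine h.trans_le (Nat.pow_le_pow_right Fintype.card_pos ?_)
    rwa [natDegree_mul_leadingCoeff_inv f hf0]

end SpecialLinear

/-! ### Passage to quotients by central subgroups -/

section CentralQuotient

variable {G H : Type*} [Group G] [Group H]

/-- If `x` commutes with the elements of `P` up to central elements, then `g ↦ [g, x]` is a
homomorphism on `P`. -/
def commutatorHom (N P : Subgroup G) (hN : N ≤ Subgroup.center G) (x : G)
    (hx : ∀ g ∈ P, g * x * g⁻¹ * x⁻¹ ∈ N) : P →* N where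
  toFun g := ⟨g * x * g⁻¹ * x⁻¹, hx g g.2⟩
  map_one' := by ext; simp
  map_mul' a b := by
    ext
    have h := Subgroup.mem_center_iff.1 (hN (hx b b.2)) (a : G)
    have h2 := Subgroup.mem_center_iff.1 (hN (hx b b.2)) (a * x * (a : G)⁻¹ * x⁻¹)
    change (a * b : G) * x * (a * b : G)⁻¹ * x⁻¹ =
      (a * x * (a : G)⁻¹ * x⁻¹) * (b * x * (b : G)⁻¹ * x⁻¹)
    rw [h2]
    calc (a * b : G) * x * (a * b : G)⁻¹ * x⁻¹
        = a * (b * x * (b : G)⁻¹ * x⁻¹) * x * (a : G)⁻¹ * x⁻¹ := by group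
      _ = _ := by rw [h]; group

/-- On the preimage `P` of the centralizer of `π x`, the map `g ↦ [g, x]` is a homomorphism into
`ker π` with kernel inside the centralizer of `x`. So `|P|` is at most `|ker π|` times the order of
that centralizer, while `|P| = |C| |ker π|`. -/
theorem MonoidHom.card_centralizer_map_le [Finite G] (π : G →* H) (hπ : Function.Surjective π)
    (hker : π.ker ≤ Subgroup.center G) (x : G) :
    Nat.card (Subgroup.centralizer ({π x} : Set H)) ≤
      Nat.card (Subgroup.centralizer ({x} : Set G)) := by
  set C := Subgroup.centralizer ({π x} : Set H)
  let P : Subgroup G := C.comap π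
  have hx : ∀ g ∈ P, g * x * g⁻¹ * x⁻¹ ∈ π.ker := fun g hg => by
    have : π g * π x = π x * π g := Subgroup.mem_centralizer_singleton_iff.1 hg
    rw [MonoidHom.mem_ker, map_mul, map_mul, map_mul, this, map_inv, map_inv]
    group
  let c := commutatorHom π.ker P hker x hx
  have h1 : Nat.card P = Nat.card c.range * Nat.card c.ker := by
    rw [← Subgroup.index_ker, mul_comm, Subgroup.card_mul_index]
  have h2 : Nat.card c.range ≤ Nat.card π.ker := Subgroup.card_le_card_group _
  have h3 : Nat.card c.ker ≤ Nat.card (Subgroup.centralizer ({x} : Set G)) := by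
    refine Nat.card_le_card_of_injective (fun g => ⟨g.1.1, ?_⟩) ?_
    · have := congrArg Subtype.val (MonoidHom.mem_ker.1 g.2)
      have h4 : g.1.1 * x * (g.1.1)⁻¹ * x⁻¹ = 1 := this
      rw [Subgroup.mem_centralizer_singleton_iff]
      rwa [mul_inv_eq_one, mul_inv_eq_iff_eq_mul] at h4
    · intro a b hab
      exact Subtype.ext (Subtype.ext (Subtype.mk.inj hab))
  have h5 : Nat.card P = Nat.card C * Nat.card π.ker := by
    have e1 := Subgroup.card_mul_index P
    rw [Subgroup.index_comap_of_surjective _ hπ] at e1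
    have e2 := Subgroup.card_mul_index C
    have e3 := Subgroup.card_mul_index π.ker
    rw [Subgroup.index_ker, MonoidHom.range_eq_top.2 hπ, Subgroup.card_top, ← e2] at e3
    have : Finite H := Finite.of_surjective π hπ
    have hpos : 0 < C.index := Nat.pos_of_ne_zero Subgroup.index_ne_zero_of_finite
    have : Nat.card P * C.index = Nat.card C * Nat.card π.ker * C.index := by
      rw [e1, ← e3]; ring
    exact Nat.eq_of_mul_eq_mul_right hpos this
  have hpos : 0 < Nat.card π.ker := Nat.card_pos
  refine Nat.le_of_mul_le_mul_right ?_ hpos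
  rw [← h5, h1, mul_comm]
  exact Nat.mul_le_mul h3 h2

theorem MonoidHom.notMem_center_of_map_notMem_center (π : G →* H) (hπ : Function.Surjective π)
    (x : G) (hx : π x ∉ Subgroup.center H) : x ∉ Subgroup.center G := fun h => hx <| by
  rw [Subgroup.mem_center_iff] at h ⊢
  intro y
  obtain ⟨y, rfl⟩ := hπ y
  rw [← map_mul, h, map_mul]

end CentralQuotient

/-! ### Centres and the order of the special linear group -/

section Center

open Matrix

variable {F : Type*} [Field F] {d : ℕ}

/-- Exhibits a transvection as a commutator, hence in the kernel of every homomorphism to an abelian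
group. The auxiliary index `k` is where `d ≥ 3` enters. -/
theorem Matrix.transvection_mul_transvection_eq (i j k : Fin d) (hij : i ≠ j) (hkj : k ≠ j)
    (c : F) :
    transvection i k 1 * transvection k j c =
      transvection i j c * (transvection k j c * transvection i k 1) := by
  have e1 : single i j c * single k j c = 0 := by
    simp [hkj.symm]
  have e2 : single k j c * single i k (1 : F) = 0 := by
    simp [hij.symm]
  have e3 : single i j c * single i k (1 : F) = 0 := by
    simp [hij.symm]
  have e4 : single i k (1 : F) * single k j c = single i j c := by simp
  simp only [transvection, add_mul, mul_add, one_mul, mul_one, e1, e2, e3, e4, add_zero]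
  abel

/-- If `x` is central modulo the centre, `g ↦ [g, x]` is a homomorphism to the centre, so it kills
transvections. Thus `x` commutes with all transvections and is scalar. -/
theorem Matrix.ProjectiveSpecialLinearGroup.center_eq_bot (hd : 3 ≤ d) :
    Subgroup.center (ProjectiveSpecialLinearGroup (Fin d) F) = ⊥ := by
  rw [eq_bot_iff]
  intro y hy
  obtain ⟨x, rfl⟩ := QuotientGroup.mk_surjective y
  rw [Subgroup.mem_bot, QuotientGroup.eq_one_iff]
  let G := SpecialLinearGroup (Fin d) F
  have hx : ∀ g ∈ (⊤ : Subgroup G), g * x * g⁻¹ * x⁻¹ ∈ Subgroup.center G := fun g _ => by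
    rw [← QuotientGroup.eq_one_iff]
    have := Subgroup.mem_center_iff.1 hy (g : G ⧸ Subgroup.center G)
    rw [QuotientGroup.mk_mul, QuotientGroup.mk_mul, QuotientGroup.mk_mul, this,
      QuotientGroup.mk_inv, QuotientGroup.mk_inv, mul_inv_cancel_right, mul_inv_cancel]
  let f := commutatorHom (Subgroup.center G) ⊤ le_rfl x hx
  have hT : ∀ t : TransvectionStruct (Fin d) F, Commute t.toMatrix (x : Matrix (Fin d) (Fin d) F) := by
    rintro ⟨i, j, hij, c⟩
    obtain ⟨k, hk⟩ : ∃ k : Fin d, k ∉ ({i, j} : Finset (Fin d)) := by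
      by_contra! h
      have h1 := Finset.card_le_card (show Finset.univ ⊆ ({i, j} : Finset (Fin d)) from
        fun k _ => h k)
      have h2 := Finset.card_le_two (a := i) (b := j)
      rw [Finset.card_univ, Fintype.card_fin] at h1
      omega
    simp only [Finset.mem_insert, Finset.mem_singleton, not_or] at hk
    let u : G := ⟨transvection i k 1, det_transvection_of_ne i k (Ne.symm hk.1) 1⟩
    let v : G := ⟨transvection k j c, det_transvection_of_ne k j hk.2 c⟩
    let t : G := ⟨transvection i j c, det_transvection_of_ne i j hij c⟩
    have huv : u * v = t * (v * u) :=
      Subtype.ext (transvection_mul_transvection_eq i j k hij hk.2 c)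
    have hf : f ⟨t, trivial⟩ = 1 := by
      have h := congrArg f (show (⟨u, trivial⟩ * ⟨v, trivial⟩ : (⊤ : Subgroup G)) =
        ⟨t, trivial⟩ * (⟨v, trivial⟩ * ⟨u, trivial⟩) from Subtype.ext huv)
      have hcomm : f ⟨v, trivial⟩ * f ⟨u, trivial⟩ = f ⟨u, trivial⟩ * f ⟨v, trivial⟩ :=
        Subtype.ext (Subgroup.mem_center_iff.1 (f ⟨u, trivial⟩).2 _)
      rw [map_mul, map_mul, map_mul, hcomm] at h
      exact right_eq_mul.1 h
    have h4 : t * x * t⁻¹ * x⁻¹ = 1 := congrArg Subtype.val hf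
    rw [mul_inv_eq_one, mul_inv_eq_iff_eq_mul] at h4
    exact congrArg Subtype.val h4
  obtain ⟨r, hr⟩ := mem_range_scalar_of_commute_transvectionStruct hT
  rw [SpecialLinearGroup.mem_center_iff]
  refine ⟨r, ?_, hr⟩
  have h2 := x.det_coe
  rw [← hr] at h2
  simpa using h2

theorem card_rootsOfUnity_eq_gcd [Fintype F] :
    Nat.card (rootsOfUnity d F) = Nat.gcd d (Fintype.card F - 1) := by
  classical
  rw [← Fintype.card_units, ← Nat.card_eq_fintype_card, Nat.gcd_comm,
    ← IsCyclic.card_powMonoidHom_ker]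
  rfl

theorem Matrix.SpecialLinearGroup.card_center [Fintype F] (hd : 0 < d) :
    Nat.card (Subgroup.center (SpecialLinearGroup (Fin d) F)) =
      Nat.gcd d (Fintype.card F - 1) := by
  rw [Nat.card_congr (SpecialLinearGroup.center_equiv_rootsOfUnity' (⟨0, hd⟩ : Fin d)).toEquiv,
    Fintype.card_fin, card_rootsOfUnity_eq_gcd]

theorem Matrix.SpecialLinearGroup.card_mul_eq [Fintype F] (hd : 0 < d) :
    Nat.card (SpecialLinearGroup (Fin d) F) * (Fintype.card F - 1) =
      ∏ i : Fin d, (Fintype.card F ^ d - Fintype.card F ^ (i : ℕ)) := by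
  classical
  rw [← Matrix.card_GL_field, ← Fintype.card_units, ← Nat.card_eq_fintype_card]
  have h1 := Subgroup.card_mul_index (GeneralLinearGroup.det (n := Fin d) (R := F)).ker
  have h2 : Function.Surjective (GeneralLinearGroup.det (n := Fin d) (R := F)) := by
    have : Nonempty (Fin d) := ⟨⟨0, hd⟩⟩
    exact GeneralLinearGroup.det_surjective
  rw [Subgroup.index_ker, MonoidHom.range_eq_top.2 h2, Subgroup.card_top] at h1
  rw [← h1]
  congr 1
  refine Nat.card_eq_of_bijective (fun A => ⟨(A : GL (Fin d) F), ?_⟩) ⟨fun A B h => ?_, fun B => ?_⟩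
  · exact SpecialLinearGroup.coeToGL_det A
  · exact Subtype.ext (congrArg (fun z => (z.1 : Matrix (Fin d) (Fin d) F)) h)
  · refine ⟨⟨B.1, ?_⟩, Subtype.ext (Units.ext rfl)⟩
    have := congrArg Units.val (MonoidHom.mem_ker.1 B.2)
    simpa using this

end Center

/-! ### Determinants and norms on cyclic modules -/

section Determinants

open Polynomial

variable {F : Type*} [Field F]

theorem LinearMap.det_eq_det_mul_det_of_exact {M₁ M₂ M₃ : Type*} [AddCommGroup M₁] [Module F M₁]
    [AddCommGroup M₂] [Module F M₂] [AddCommGroup M₃] [Module F M₃] [FiniteDimensional F M₂]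
    (i : M₁ →ₗ[F] M₂) (π : M₂ →ₗ[F] M₃) (hi : Function.Injective i) (hπ : Function.Surjective π)
    (hex : LinearMap.ker π = LinearMap.range i) (T₁ : M₁ →ₗ[F] M₁) (T₂ : M₂ →ₗ[F] M₂)
    (T₃ : M₃ →ₗ[F] M₃) (h₁ : ∀ m, T₂ (i m) = i (T₁ m)) (h₂ : ∀ m, π (T₂ m) = T₃ (π m)) :
    LinearMap.det T₂ = LinearMap.det T₁ * LinearMap.det T₃ := by
  have hW : LinearMap.ker π ≤ (LinearMap.ker π).comap T₂ := fun m hm => by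
    rw [Submodule.mem_comap, LinearMap.mem_ker, h₂, LinearMap.mem_ker.1 hm, map_zero]
  rw [LinearMap.det_eq_det_mul_det (LinearMap.ker π) T₂ hW]
  congr 1
  · let e : M₁ ≃ₗ[F] LinearMap.ker π :=
      (LinearEquiv.ofInjective i hi).trans (LinearEquiv.ofEq _ _ hex.symm)
    have he : ∀ m, (e m : M₂) = i m := fun m => rfl
    rw [← LinearMap.det_conj T₁ e]
    congr 1
    ext ⟨m, hm⟩
    obtain ⟨m', rfl⟩ : ∃ m', i m' = m := by rwa [hex] at hm
    have : e.symm ⟨i m', hm⟩ = m' := by rw [LinearEquiv.symm_apply_eq]; rfl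
    simp [he, this, h₁]
  · let e : (M₂ ⧸ LinearMap.ker π) ≃ₗ[F] M₃ := π.quotKerEquivOfSurjective hπ
    rw [← LinearMap.det_conj _ e]
    congr 1
    ext m
    obtain ⟨m, rfl⟩ := hπ m
    have : e.symm (π m) = Submodule.Quotient.mk m := by
      rw [LinearEquiv.symm_apply_eq]; rfl
    simp only [LinearMap.comp_apply, LinearEquiv.coe_coe, this]
    rw [Submodule.mapQ_apply, ← h₂]
    rfl

theorem LinearMap.det_pi_map {ι : Type*} [Fintype ι] [LinearOrder ι] {M : ι → Type*}
    [∀ i, AddCommGroup (M i)] [∀ i, Module F (M i)] [∀ i, FiniteDimensional F (M i)]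
    (T : ∀ i, M i →ₗ[F] M i) (S : (Π i, M i) →ₗ[F] (Π i, M i))
    (hS : ∀ v i, S v i = T i (v i)) : LinearMap.det S = ∏ i, LinearMap.det (T i) := by
  classical
  let b := fun i => Module.finBasis F (M i)
  rw [← LinearMap.det_toMatrix (Pi.basis b)]
  have : LinearMap.toMatrix (Pi.basis b) (Pi.basis b) S =
      Matrix.blockDiagonal' fun i => LinearMap.toMatrix (b i) (b i) (T i) := by
    ext ⟨i, s⟩ ⟨j, t⟩
    rw [LinearMap.toMatrix_apply, Pi.basis_repr, hS, Pi.basis_apply]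
    by_cases hij : i = j
    · subst hij
      rw [Matrix.blockDiagonal'_apply_eq, LinearMap.toMatrix_apply]
      simp
    · rw [Matrix.blockDiagonal'_apply_ne _ _ _ hij]
      simp [hij]
  rw [this, (Matrix.blockTriangular_blockDiagonal' _).det_fintype]
  refine Finset.prod_congr rfl fun i _ => ?_
  let e : Fin (Module.finrank F (M i)) ≃
      {a : Σ i, Fin (Module.finrank F (M i)) // a.1 = i} :=
    ⟨fun s => ⟨⟨i, s⟩, rfl⟩, fun a => a.2 ▸ a.1.2, fun s => rfl, by rintro ⟨⟨j, s⟩, rfl⟩; rfl⟩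
  rw [← Matrix.det_submatrix_equiv_self e, ← LinearMap.det_toMatrix (b i)]
  congr 1
  ext s t
  exact Matrix.blockDiagonal'_apply_eq (fun i => LinearMap.toMatrix (b i) (b i) (T i)) i s t

/-- Induction along the exact sequence `0 → F[X]/(p) → F[X]/(p^(k+1)) → F[X]/(p^k) → 0`, whose first
map is multiplication by `p^k`; determinants multiply. -/
theorem AdjoinRoot.norm_mk_pow (p : F[X]) (hp : p.Monic) (f : F[X]) (k : ℕ) :
    Algebra.norm F (AdjoinRoot.mk (p ^ k) f) = Algebra.norm F (AdjoinRoot.mk p f) ^ k := by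
  have hfin : ∀ k, FiniteDimensional F (AdjoinRoot (p ^ k)) := fun k =>
    (AdjoinRoot.powerBasis (pow_ne_zero k hp.ne_zero)).finite
  induction k with
  | zero =>
    have : Subsingleton (AdjoinRoot (p ^ 0)) := by
      rw [pow_zero]
      exact Ideal.Quotient.subsingleton_iff.2 Ideal.span_singleton_one
    rw [pow_zero (Algebra.norm F (AdjoinRoot.mk p f)), Algebra.norm_apply,
      LinearMap.det_eq_one_of_subsingleton]
  | succ k ih =>
    have := hfin (k + 1)
    let π : AdjoinRoot (p ^ (k + 1)) →ₐ[F] AdjoinRoot (p ^ k) :=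
      AdjoinRoot.algHomOfDvd F (p ^ (k + 1)) (p ^ k) (pow_dvd_pow p k.le_succ)
    have hπ : ∀ g, π (AdjoinRoot.mk _ g) = AdjoinRoot.mk _ g := fun g => by
      have : π.comp (AdjoinRoot.mkₐ (p ^ (k + 1))) = AdjoinRoot.mkₐ (p ^ k) := by
        ext; simp [π]
      exact DFunLike.congr_fun this g
    let i₀ : F[X] →ₗ[F] AdjoinRoot (p ^ (k + 1)) :=
      (AdjoinRoot.mkₐ (p ^ (k + 1))).toLinearMap ∘ₗ LinearMap.mulLeft F (p ^ k)
    have hi₀ : ∀ g, i₀ g = AdjoinRoot.mk _ (p ^ k * g) := fun g => rfl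
    have hker : ∀ g, i₀ g = 0 ↔ p ∣ g := fun g => by
      rw [hi₀, AdjoinRoot.mk_eq_zero, pow_succ, mul_dvd_mul_iff_left (pow_ne_zero k hp.ne_zero)]
    let i : AdjoinRoot p →ₗ[F] AdjoinRoot (p ^ (k + 1)) :=
      ((Ideal.span {p}).restrictScalars F).liftQ i₀ fun g hg => by
        rw [LinearMap.mem_ker, hker]
        exact Ideal.mem_span_singleton.1 hg
    have hi : ∀ g, i (AdjoinRoot.mk p g) = AdjoinRoot.mk _ (p ^ k * g) := fun g => rfl
    rw [pow_succ' (Algebra.norm F (AdjoinRoot.mk p f)), ← ih]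
    refine LinearMap.det_eq_det_mul_det_of_exact i π.toLinearMap ?_ ?_ ?_ _ _ _ ?_ ?_
    · rw [← LinearMap.ker_eq_bot, LinearMap.ker_eq_bot']
      intro m hm
      obtain ⟨g, rfl⟩ := AdjoinRoot.mk_surjective m
      rw [AdjoinRoot.mk_eq_zero]
      exact (hker g).1 hm
    · intro m
      obtain ⟨g, rfl⟩ := AdjoinRoot.mk_surjective m
      exact ⟨AdjoinRoot.mk _ g, hπ g⟩
    · ext m
      obtain ⟨g, rfl⟩ := AdjoinRoot.mk_surjective m
      rw [LinearMap.mem_ker, AlgHom.toLinearMap_apply, hπ, AdjoinRoot.mk_eq_zero]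
      constructor
      · rintro ⟨c, rfl⟩
        exact ⟨AdjoinRoot.mk p c, hi c⟩
      · rintro ⟨m', hm'⟩
        obtain ⟨c, rfl⟩ := AdjoinRoot.mk_surjective m'
        rw [hi, AdjoinRoot.mk_eq_mk] at hm'
        have h1 : p ^ k ∣ p ^ k * c - g := (pow_dvd_pow p k.le_succ).trans hm'
        exact (dvd_sub_right (dvd_mul_right _ _)).1 h1
    · intro m
      obtain ⟨g, rfl⟩ := AdjoinRoot.mk_surjective m
      change AdjoinRoot.mk _ f * i (AdjoinRoot.mk p g) = i (AdjoinRoot.mk p f * AdjoinRoot.mk p g)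
      rw [← map_mul, hi, hi, ← map_mul, mul_left_comm]
    · intro m
      obtain ⟨g, rfl⟩ := AdjoinRoot.mk_surjective m
      change π (AdjoinRoot.mk _ f * AdjoinRoot.mk _ g) = AdjoinRoot.mk _ f * π (AdjoinRoot.mk _ g)
      rw [← map_mul, hπ, hπ, ← map_mul]

theorem AdjoinRoot.norm_root (p : F[X]) (hp : p.Monic) :
    Algebra.norm F (AdjoinRoot.root p) = (-1) ^ p.natDegree * p.coeff 0 := by
  have h := Algebra.PowerBasis.norm_gen_eq_coeff_zero_minpoly (AdjoinRoot.powerBasis hp.ne_zero)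
  rw [AdjoinRoot.powerBasis_gen, AdjoinRoot.powerBasis_dim, AdjoinRoot.minpoly_root hp.ne_zero,
    hp.leadingCoeff, inv_one, map_one, mul_one] at h
  exact h

theorem AdjoinRoot.exists_algEquiv_scaleRoots (Q : F[X]) (ζ : Fˣ) :
    ∃ ψ : AdjoinRoot Q ≃ₐ[F] AdjoinRoot (Q.scaleRoots ζ),
      (ζ : F) • ψ (AdjoinRoot.root Q) = AdjoinRoot.root (Q.scaleRoots ζ) := by
  have h0 : ∀ P : F[X], aeval (AdjoinRoot.root P) P = 0 := fun P => AdjoinRoot.eval₂_root P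
  have hQ : (Q.scaleRoots (ζ : F)).scaleRoots ((ζ⁻¹ : Fˣ) : F) = Q := by
    rw [← scaleRoots_mul, Units.mul_inv, scaleRoots_one]
  have h1 : aeval (algebraMap F _ ((ζ⁻¹ : Fˣ) : F) * AdjoinRoot.root (Q.scaleRoots (ζ : F))) Q
      = 0 := by
    have h := scaleRoots_aeval_eq_zero (r := ((ζ⁻¹ : Fˣ) : F)) (h0 (Q.scaleRoots (ζ : F)))
    rwa [hQ] at h
  have h2 : aeval (algebraMap F _ (ζ : F) * AdjoinRoot.root Q) (Q.scaleRoots (ζ : F)) = 0 :=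
    scaleRoots_aeval_eq_zero (h0 Q)
  let f := AdjoinRoot.liftAlgHom Q (Algebra.ofId F _) _ h1
  let g := AdjoinRoot.liftAlgHom (Q.scaleRoots (ζ : F)) (Algebra.ofId F _) _ h2
  have hf : f (AdjoinRoot.root Q) =
      algebraMap F _ ((ζ⁻¹ : Fˣ) : F) * AdjoinRoot.root (Q.scaleRoots (ζ : F)) :=
    AdjoinRoot.liftAlgHom_root ..
  have hg : g (AdjoinRoot.root (Q.scaleRoots (ζ : F))) =
      algebraMap F _ (ζ : F) * AdjoinRoot.root Q :=
    AdjoinRoot.liftAlgHom_root ..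
  refine ⟨AlgEquiv.ofAlgHom f g ?_ ?_, ?_⟩
  · apply AdjoinRoot.algHom_ext
    rw [AlgHom.comp_apply, hg, map_mul, hf, AlgHom.commutes, ← mul_assoc, ← map_mul,
      Units.mul_inv, map_one, one_mul]
    rfl
  · apply AdjoinRoot.algHom_ext
    rw [AlgHom.comp_apply, hf, map_mul, hg, AlgHom.commutes, ← mul_assoc, ← map_mul,
      Units.inv_mul, map_one, one_mul]
    rfl
  · change (ζ : F) • f (AdjoinRoot.root Q) = _
    rw [hf, Algebra.smul_def, ← mul_assoc, ← map_mul, Units.mul_inv, map_one, one_mul]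

end Determinants

/-! ### Types: `GL`-conjugacy, determinants of centralizers, scaling -/

section Types

open Polynomial Matrix

universe u

variable {F : Type u} [Field F] {d : ℕ}

/-- The matrix `x` has type `g` if the space decomposes under `x` as the direct sum of the cyclic
modules `F[X] ⧸ (p ^ (j + 1))`, with `p` running over the irreducible factors of `g j`. -/
def Matrix.IsTypeOf (x : Matrix (Fin d) (Fin d) F) (g : Fin d → F[X]) : Prop :=
  ∃ (n : ℕ) (p : Fin n → F[X]) (e : Fin n → Fin d), (∀ i, (p i).Monic ∧ Irreducible (p i)) ∧
    (∀ j, g j = ∏ i with e i = j, p i) ∧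
    ∃ φ : (Fin d → F) ≃ₗ[F] (Π i, AdjoinRoot (p i ^ ((e i : ℕ) + 1))),
      ∀ v i, φ (x *ᵥ v) i = AdjoinRoot.root (p i ^ ((e i : ℕ) + 1)) * φ v i

theorem Polynomial.scaleRoots_scaleRoots_inv (f : F[X]) (ζ : Fˣ) :
    (f.scaleRoots (ζ : F)).scaleRoots ((ζ⁻¹ : Fˣ) : F) = f := by
  rw [← scaleRoots_mul, Units.mul_inv, scaleRoots_one]

theorem Irreducible.scaleRoots {f : F[X]} (hf : Irreducible f) (ζ : Fˣ) :
    Irreducible (f.scaleRoots (ζ : F)) := by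
  have hu : ∀ (ζ : Fˣ) (a : F[X]), IsUnit a → IsUnit (a.scaleRoots (ζ : F)) := fun ζ a ha => by
    obtain ⟨r, hr, rfl⟩ := Polynomial.isUnit_iff.1 ha
    rw [scaleRoots_C]
    exact ha
  refine ⟨fun h => hf.not_isUnit ?_, fun a b hab => ?_⟩
  · have := hu ζ⁻¹ _ h
    rwa [scaleRoots_scaleRoots_inv] at this
  · have h := congrArg (fun t => t.scaleRoots ((ζ⁻¹ : Fˣ) : F)) hab
    simp only [scaleRoots_scaleRoots_inv, mul_scaleRoots_of_noZeroDivisors] at h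
    refine (hf.isUnit_or_isUnit h).imp (fun h => ?_) fun h => ?_ <;>
    · have := hu ζ _ h
      rwa [← scaleRoots_mul, Units.inv_mul, scaleRoots_one] at this

theorem sum_natDegree_of_linearEquiv {ι : Type*} [Fintype ι] {Q : ι → F[X]} (hQ : ∀ i, Q i ≠ 0)
    (φ : (Fin d → F) ≃ₗ[F] (Π i, AdjoinRoot (Q i))) : ∑ i, (Q i).natDegree = d := by
  have : ∀ i, FiniteDimensional F (AdjoinRoot (Q i)) := fun i =>
    (AdjoinRoot.powerBasis (hQ i)).finite
  have h := φ.finrank_eq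
  rw [Module.finrank_fin_fun, Module.finrank_pi_fintype] at h
  rw [h]
  refine Finset.sum_congr rfl fun i _ => ?_
  rw [(AdjoinRoot.powerBasis (hQ i)).finrank, AdjoinRoot.powerBasis_dim]

theorem Matrix.exists_isTypeOf (x : Matrix (Fin d) (Fin d) F) : ∃ g, x.IsTypeOf g := by
  obtain ⟨ι, _, p, e, hp, he, φ, hφ⟩ := x.exists_primary_decomposition
  have hQ : ∀ i, p i ^ e i ≠ 0 := fun i => pow_ne_zero _ (hp i).1.ne_zero
  have hsum := sum_natDegree_of_linearEquiv hQ φ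
  -- Exponents lie between `1` and `d`, so they can be indexed by `Fin d` with a shift by one.
  have hle : ∀ i, e i ≤ d := fun i => by
    have h1 : (p i ^ e i).natDegree ≤ d := by
      rw [← hsum]
      exact Finset.single_le_sum (f := fun i => (p i ^ e i).natDegree) (fun _ _ => Nat.zero_le _)
        (Finset.mem_univ i)
    rw [natDegree_pow] at h1
    have := (hp i).2.natDegree_pos
    nlinarith
  obtain ⟨e', rfl⟩ : ∃ e' : ι → Fin d, e = fun i => (e' i : ℕ) + 1 :=
    ⟨fun i => ⟨e i - 1, by have := he i; have := hle i; omega⟩, funext fun i => by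
      have := he i
      simp only
      omega⟩
  let σ : Fin (Fintype.card ι) ≃ ι := (Fintype.equivFin ι).symm
  refine ⟨_, _, fun i => p (σ i), fun i => e' (σ i), fun i => hp _, fun j => rfl,
    φ.trans (LinearEquiv.piCongrLeft F (fun i => AdjoinRoot (p i ^ ((e' i : ℕ) + 1))) σ).symm, ?_⟩
  intro v i
  exact hφ v (σ i)

theorem Matrix.prod_univ_eq_prod_filter {n : ℕ} {M : Type*} [CommMonoid M] (e : Fin n → Fin d)
    (f : Fin n → M) : ∏ i, f i ^ ((e i : ℕ) + 1) = ∏ j, (∏ i with e i = j, f i) ^ ((j : ℕ) + 1) := by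
  rw [← Finset.prod_fiberwise (s := Finset.univ) (g := e)]
  refine Finset.prod_congr rfl fun j _ => ?_
  rw [← Finset.prod_pow]
  refine Finset.prod_congr rfl fun i hi => ?_
  rw [(Finset.mem_filter.1 hi).2]

theorem Matrix.det_of_primary {n : ℕ} {p : Fin n → F[X]} (hp : ∀ i, (p i).Monic) {k : Fin n → ℕ}
    (φ : (Fin d → F) ≃ₗ[F] (Π i, AdjoinRoot (p i ^ k i))) (u : Fin n → F[X])
    (h : Matrix (Fin d) (Fin d) F)
    (hh : ∀ v i, φ (h *ᵥ v) i = AdjoinRoot.mk (p i ^ k i) (u i) * φ v i) :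
    h.det = ∏ i, Algebra.norm F (AdjoinRoot.mk (p i) (u i)) ^ k i := by
  have : ∀ i, FiniteDimensional F (AdjoinRoot (p i ^ k i)) := fun i =>
    (AdjoinRoot.powerBasis (pow_ne_zero _ (hp i).ne_zero)).finite
  rw [← LinearMap.det_toLin', ← LinearMap.det_conj _ φ,
    LinearMap.det_pi_map (fun i => Algebra.lmul F _ (AdjoinRoot.mk (p i ^ k i) (u i)))]
  · exact Finset.prod_congr rfl fun i _ => AdjoinRoot.norm_mk_pow (p i) (hp i) (u i) (k i)
  · intro v i
    have := hh (φ.symm v) i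
    rw [LinearEquiv.apply_symm_apply] at this
    exact this

namespace Matrix.IsTypeOf

variable {x y : Matrix (Fin d) (Fin d) F} {g : Fin d → F[X]}

theorem monic (hx : x.IsTypeOf g) (j : Fin d) : (g j).Monic := by
  obtain ⟨n, p, e, hp, hg, -⟩ := hx
  rw [hg]
  exact monic_prod_of_monic _ _ fun i _ => (hp i).1

theorem sum_natDegree (hx : x.IsTypeOf g) : ∑ j : Fin d, ((j : ℕ) + 1) * (g j).natDegree = d := by
  obtain ⟨n, p, e, hp, hg, φ, -⟩ := hx
  refine Eq.trans ?_ (sum_natDegree_of_linearEquiv (fun i => pow_ne_zero _ (hp i).1.ne_zero) φ)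
  simp_rw [natDegree_pow, hg, natDegree_prod_of_monic _ _ fun i _ => (hp i).1]
  rw [← Finset.sum_fiberwise (s := Finset.univ) (g := e)]
  refine Finset.sum_congr rfl fun j _ => ?_
  rw [Finset.mul_sum]
  refine Finset.sum_congr rfl fun i hi => ?_
  rw [(Finset.mem_filter.1 hi).2]

theorem det_eq (hx : x.IsTypeOf g) :
    x.det = ∏ j : Fin d, ((-1) ^ (g j).natDegree * (g j).coeff 0) ^ ((j : ℕ) + 1) := by
  obtain ⟨n, p, e, hp, hg, φ, hφ⟩ := hx
  rw [det_of_primary (fun i => (hp i).1) φ (fun _ => X) x hφ]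
  simp_rw [AdjoinRoot.mk_X, AdjoinRoot.norm_root _ (hp _).1]
  rw [prod_univ_eq_prod_filter]
  refine Finset.prod_congr rfl fun j _ => ?_
  rw [Finset.prod_mul_distrib, Finset.prod_pow_eq_pow_sum, hg,
    natDegree_prod_of_monic _ _ fun i _ => (hp i).1, coeff_zero_prod]

/-- Unique factorization of `g j` recovers the primes occurring with exponent `j + 1`, with
multiplicity. The two decompositions therefore agree up to a permutation `σ` of the factors. -/
theorem exists_conj (hx : x.IsTypeOf g) (hy : y.IsTypeOf g) :
    ∃ h : GL (Fin d) F, (h : Matrix (Fin d) (Fin d) F) * x = y * h := by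
  classical
  obtain ⟨n, p, e, hp, hg, φ, hφ⟩ := hx
  obtain ⟨n', p', e', hp', hg', φ', hφ'⟩ := hy
  have key : ∀ {n : ℕ} (p : Fin n → F[X]) (e : Fin n → Fin d),
      (∀ i, (p i).Monic ∧ Irreducible (p i)) → (∀ j, g j = ∏ i with e i = j, p i) →
      ∀ y : F[X] × Fin d, Fintype.card {i // (p i, e i) = y} =
        (UniqueFactorizationMonoid.normalizedFactors (g y.2)).count y.1 := by
    rintro n p e hp hg ⟨P, j⟩
    have h1 := UniqueFactorizationMonoid.normalizedFactors_prod_eq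
      (((Finset.univ.filter fun i => e i = j).val).map p) (fun a ha => by
        obtain ⟨i, -, rfl⟩ := Multiset.mem_map.1 ha
        exact (hp i).2)
    have h2 : (((Finset.univ.filter fun i => e i = j).val).map p).map normalize =
        ((Finset.univ.filter fun i => e i = j).val).map p := by
      rw [Multiset.map_map]
      exact Multiset.map_congr rfl fun i _ => (hp i).1.normalize_eq_self
    rw [h2] at h1
    rw [hg]
    change _ = Multiset.count P (UniqueFactorizationMonoid.normalizedFactors
      (Multiset.map p (Finset.univ.filter fun i => e i = j).val).prod)
    rw [h1, Multiset.count_map, Fintype.card_subtype, ← Finset.filter_val, Finset.filter_filter]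
    change _ = Finset.card _
    congr 1
    ext i
    simp only [Finset.mem_filter, Finset.mem_univ, true_and, Prod.mk.injEq]
    tauto
  have hcard : ∀ y : F[X] × Fin d, Nonempty ({i // (p i, e i) = y} ≃ {i // (p' i, e' i) = y}) :=
    fun y => Fintype.card_eq.1 ((key p e hp hg y).trans (key p' e' hp' hg' y).symm)
  obtain ⟨σ, hσ⟩ : ∃ σ : Fin n ≃ Fin n', ∀ i, (p' (σ i), e' (σ i)) = (p i, e i) :=
    ⟨Equiv.ofFiberEquiv fun y => (hcard y).some, fun i =>
      Equiv.ofFiberEquiv_map (f := fun i => (p i, e i)) (g := fun i => (p' i, e' i)) _ i⟩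
  clear hcard key
  obtain rfl : p = fun i => p' (σ i) := funext fun i => (congrArg Prod.fst (hσ i)).symm
  obtain rfl : e = fun i => e' (σ i) := funext fun i => (congrArg Prod.snd (hσ i)).symm
  let ψ : (Fin d → F) ≃ₗ[F] (Fin d → F) := (φ'.trans (LinearEquiv.piCongrLeft F
    (fun i => AdjoinRoot (p' i ^ ((e' i : ℕ) + 1))) σ).symm).trans φ.symm
  have hψ : ∀ v, ψ (y *ᵥ v) = x *ᵥ (ψ v) := fun v => by
    apply φ.injective
    ext i
    rw [hφ]
    simp only [ψ, LinearEquiv.trans_apply, LinearEquiv.apply_symm_apply]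
    exact hφ' v (σ i)
  refine ⟨⟨LinearMap.toMatrix' ψ.symm.toLinearMap, LinearMap.toMatrix' ψ.toLinearMap, ?_, ?_⟩, ?_⟩
  · rw [← LinearMap.toMatrix'_comp, LinearEquiv.symm_comp, LinearMap.toMatrix'_id]
  · rw [← LinearMap.toMatrix'_comp, LinearEquiv.comp_symm, LinearMap.toMatrix'_id]
  · change LinearMap.toMatrix' ψ.symm.toLinearMap * x = y * LinearMap.toMatrix' ψ.symm.toLinearMap
    apply Matrix.toLin'.injective
    refine LinearMap.ext fun v => ψ.injective ?_
    simp only [Matrix.toLin'_apply, ← Matrix.mulVec_mulVec, LinearMap.toMatrix'_mulVec, hψ,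
      LinearEquiv.coe_coe, LinearEquiv.apply_symm_apply]

/-- Multiplication by a unit on each cyclic factor commutes with `x`, and norms between finite
fields are surjective, so the norms on the factors can be prescribed. -/
theorem exists_commute_det_eq [Fintype F] (hx : x.IsTypeOf g) (c : Fin d → Fˣ)
    (hc : ∀ j, g j = 1 → c j = 1) :
    ∃ h : GL (Fin d) F, (h : Matrix (Fin d) (Fin d) F) * x = x * h ∧
      GeneralLinearGroup.det h = ∏ j : Fin d, c j ^ ((j : ℕ) + 1) := by
  classical
  obtain ⟨n, p, e, hp, hg, φ, hφ⟩ := hx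
  -- One chosen factor for each nontrivial `g j` carries all of `c j`; the others get norm `1`.
  obtain ⟨a, ha⟩ : ∃ a : Fin n → Fˣ, ∀ j, ∏ i with e i = j, a i = c j := by
    have hs : ∀ j, g j ≠ 1 → ∃ i, e i = j := fun j hj => by
      by_contra! h
      apply hj
      rw [hg, Finset.filter_false_of_mem fun i _ => h i, Finset.prod_empty]
    choose s hs using hs
    refine ⟨fun i => if hj : g (e i) ≠ 1 then if i = s (e i) hj then c (e i) else 1 else 1,
      fun j => ?_⟩
    by_cases hj : g j = 1
    · rw [hc j hj]
      refine Finset.prod_eq_one fun i hi => ?_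
      rw [dif_neg]
      rwa [(Finset.mem_filter.1 hi).2, not_not]
    · rw [Finset.prod_eq_single (s j hj)]
      · have : ∀ k (hk : k = j), (if hj : g k ≠ 1 then if s j (by assumption) = s k hj
            then c k else 1 else 1) = c j := by
          rintro k rfl
          rw [dif_pos hj, if_pos rfl]
        exact this _ (hs j hj)
      · intro i hi hne
        have hij := (Finset.mem_filter.1 hi).2
        subst hij
        rw [dif_pos hj, if_neg hne]
      · intro h
        exact absurd (by simpa using hs j hj) h
  have hu : ∀ i, ∃ u : F[X], Algebra.norm F (AdjoinRoot.mk (p i) u) = a i := fun i => by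
    have : Fact (Irreducible (p i)) := ⟨(hp i).2⟩
    have : FiniteDimensional F (AdjoinRoot (p i)) :=
      (AdjoinRoot.powerBasis (hp i).1.ne_zero).finite
    have : Finite (AdjoinRoot (p i)) := Module.finite_of_finite F
    obtain ⟨z, hz⟩ := FiniteField.norm_surjective F (AdjoinRoot (p i)) (a i)
    obtain ⟨u, rfl⟩ := AdjoinRoot.mk_surjective z
    exact ⟨u, hz⟩
  choose u hu using hu
  let T : (Fin d → F) →ₗ[F] (Fin d → F) := φ.symm.toLinearMap ∘ₗ
    (LinearMap.pi fun i => Algebra.lmul F _ (AdjoinRoot.mk (p i ^ ((e i : ℕ) + 1)) (u i)) ∘ₗ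
      LinearMap.proj i) ∘ₗ φ.toLinearMap
  let h := LinearMap.toMatrix' T
  have hT : ∀ v i, φ (h *ᵥ v) i = AdjoinRoot.mk (p i ^ ((e i : ℕ) + 1)) (u i) * φ v i := by
    intro v i
    rw [LinearMap.toMatrix'_mulVec]
    simp [T]
  have hdet : h.det = ((∏ j : Fin d, c j ^ ((j : ℕ) + 1) : Fˣ) : F) := by
    rw [det_of_primary (fun i => (hp i).1) φ u h hT]
    simp_rw [hu, ← Units.val_pow_eq_pow_val]
    rw [← Units.coe_prod, prod_univ_eq_prod_filter]
    simp_rw [ha]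
  refine ⟨GeneralLinearGroup.mkOfDetNeZero h (by rw [hdet]; exact Units.ne_zero _), ?_,
    Units.ext hdet⟩
  change h * x = x * h
  apply Matrix.toLin'.injective
  refine LinearMap.ext fun v => φ.injective (funext fun i => ?_)
  simp only [Matrix.toLin'_apply, ← Matrix.mulVec_mulVec, hT, hφ]
  ring

theorem smul (hx : x.IsTypeOf g) (ζ : Fˣ) :
    ((ζ : F) • x).IsTypeOf fun j => (g j).scaleRoots ζ := by
  obtain ⟨n, p, e, hp, hg, φ, hφ⟩ := hx
  have hψ : ∀ i, ∃ ψ : AdjoinRoot (p i ^ ((e i : ℕ) + 1)) ≃ₐ[F]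
      AdjoinRoot ((p i).scaleRoots ζ ^ ((e i : ℕ) + 1)),
      (ζ : F) • ψ (AdjoinRoot.root _) = AdjoinRoot.root _ := fun i => by
    rw [← pow_scaleRoots_of_isReduced]
    exact AdjoinRoot.exists_algEquiv_scaleRoots _ ζ
  choose ψ hψ using hψ
  refine ⟨n, fun i => (p i).scaleRoots ζ, e, fun i => ⟨?_, ?_⟩, fun j => ?_,
    φ.trans (LinearEquiv.piCongrRight fun i => (ψ i).toLinearEquiv), fun v i => ?_⟩
  · exact (monic_scaleRoots_iff _).2 (hp i).1
  · exact (hp i).2.scaleRoots ζ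
  · let S : F[X] →* F[X] := ⟨⟨fun f => f.scaleRoots ζ, one_scaleRoots _⟩,
      fun a b => mul_scaleRoots_of_noZeroDivisors a b _⟩
    simp only [hg]
    exact map_prod S _ _
  · simp only [LinearEquiv.trans_apply, LinearEquiv.piCongrRight_apply, Matrix.smul_mulVec,
      map_smul, Pi.smul_apply, hφ]
    change (ζ : F) • ψ i (_ * _) = _
    rw [map_mul, ← smul_mul_assoc, hψ]
    rfl

end Matrix.IsTypeOf

end Types

/-! ### Weighted sums over partitions -/

section Shapes

/-- The multiplicity functions of partitions of `n` into parts `1, …, D`; the multiplicity of the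
part `j + 1` is `m j`. -/
def shapes (D n : ℕ) : Finset (Fin D → ℕ) :=
  (Fintype.piFinset fun _ => Finset.range (n + 1)).filter fun m => ∑ j : Fin D, ((j : ℕ) + 1) * m j = n

theorem mem_shapes {D n : ℕ} {m : Fin D → ℕ} :
    m ∈ shapes D n ↔ ∑ j : Fin D, ((j : ℕ) + 1) * m j = n := by
  rw [shapes, Finset.mem_filter, and_iff_right_iff_imp, Fintype.mem_piFinset]
  intro h j
  rw [Finset.mem_range, Nat.lt_succ_iff, ← h]
  refine le_trans ?_ (Finset.single_le_sum (f := fun j : Fin D => ((j : ℕ) + 1) * m j)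
    (fun _ _ => Nat.zero_le _) (Finset.mem_univ j))
  exact Nat.le_mul_of_pos_left _ (Nat.succ_pos _)

theorem one_sub_sum_le_prod_one_sub {ι : Type*} (s : Finset ι) (y : ι → ℝ)
    (h0 : ∀ j ∈ s, 0 ≤ y j) (h1 : ∀ j ∈ s, y j ≤ 1) : 1 - ∑ j ∈ s, y j ≤ ∏ j ∈ s, (1 - y j) := by
  classical
  induction s using Finset.induction_on with
  | empty => simp
  | insert a s ha ih =>
    rw [Finset.sum_insert ha, Finset.prod_insert ha]
    have hi := ih (fun j hj => h0 j (Finset.mem_insert_of_mem hj))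
      (fun j hj => h1 j (Finset.mem_insert_of_mem hj))
    have ha0 := h0 a (Finset.mem_insert_self a s)
    have ha1 := h1 a (Finset.mem_insert_self a s)
    have hs : 0 ≤ ∑ j ∈ s, y j :=
      Finset.sum_nonneg fun j hj => h0 j (Finset.mem_insert_of_mem hj)
    nlinarith [mul_le_mul_of_nonneg_left hi (sub_nonneg.2 ha1)]

theorem sum_inv_pow_le {ι : Type*} (q : ℝ) (hq : 3 ≤ q) (J : Finset ι) (w : ι → ℕ)
    (hw : ∀ j ∈ J, 1 ≤ w j) (hinj : Set.InjOn w J) :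
    ∑ j ∈ J, (q⁻¹) ^ w j ≤ 1 / (q - 1) := by
  have hq0 : 0 < q⁻¹ := inv_pos.2 (by linarith)
  have hq1 : q⁻¹ < 1 := inv_lt_one_of_one_lt₀ (by linarith)
  rw [← Finset.sum_image (f := fun i => (q⁻¹) ^ i) (g := w) hinj]
  have hs : Summable fun i : ℕ => (q⁻¹) ^ i := summable_geometric_of_lt_one hq0.le hq1
  have h1 := hs.sum_le_tsum (insert 0 (J.image w)) fun i _ => (pow_pos hq0 i).le
  rw [tsum_geometric_of_lt_one hq0.le hq1, Finset.sum_insert] at h1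
  · have : (1 - q⁻¹)⁻¹ = 1 + 1 / (q - 1) := by
      have : q - 1 ≠ 0 := by linarith
      field_simp
      ring
    rw [this, pow_zero] at h1
    linarith
  · intro h
    obtain ⟨j, hj, h⟩ := Finset.mem_image.1 h
    have := hw j hj
    omega

theorem div_le_prod_one_sub_inv_pow {ι : Type*} (q : ℝ) (hq : 3 ≤ q) (J : Finset ι) (w : ι → ℕ)
    (hw : ∀ j ∈ J, 1 ≤ w j) (hinj : Set.InjOn w J) :
    (q - 2) / (q - 1) ≤ ∏ j ∈ J, (1 - (q⁻¹) ^ w j) := by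
  have hq0 : 0 < q⁻¹ := inv_pos.2 (by linarith)
  have hq1 : q⁻¹ < 1 := inv_lt_one_of_one_lt₀ (by linarith)
  refine le_trans ?_ (one_sub_sum_le_prod_one_sub J _ (fun j _ => (pow_pos hq0 _).le)
    fun j _ => pow_le_one₀ hq0.le hq1.le)
  have : (q - 2) / (q - 1) = 1 - 1 / (q - 1) := by
    have : q - 1 ≠ 0 := by linarith
    field_simp
    ring
  rw [this]
  linarith [sum_inv_pow_le q hq J w hw hinj]

theorem prod_geom_sum_le {D : ℕ} (q : ℝ) (hq : 3 ≤ q) (J : Finset (Fin D)) (w : Fin D → ℕ)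
    (hw : ∀ j ∈ J, 1 ≤ w j) (hinj : Set.InjOn w J) (n : ℕ) :
    ∏ j ∈ J, ∑ k ∈ Finset.range n, ((q⁻¹) ^ w j) ^ k ≤ (q - 1) / (q - 2) := by
  have hq0 : 0 < q⁻¹ := inv_pos.2 (by linarith)
  have hq1 : q⁻¹ < 1 := inv_lt_one_of_one_lt₀ (by linarith)
  have hy0 : ∀ j, 0 < (q⁻¹) ^ w j := fun j => pow_pos hq0 _
  have hy1 : ∀ j ∈ J, (q⁻¹) ^ w j < 1 := fun j hj =>
    pow_lt_one₀ hq0.le hq1 (Nat.one_le_iff_ne_zero.1 (hw j hj))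
  have hprod := div_le_prod_one_sub_inv_pow q hq J w hw hinj
  have hgeom : ∏ j ∈ J, ∑ k ∈ Finset.range n, ((q⁻¹) ^ w j) ^ k ≤
      ∏ j ∈ J, (1 - (q⁻¹) ^ w j)⁻¹ := by
    refine Finset.prod_le_prod (fun j _ => Finset.sum_nonneg fun k _ => pow_nonneg (hy0 j).le _)
      fun j hj => ?_
    rw [← tsum_geometric_of_lt_one (hy0 j).le (hy1 j hj)]
    exact (summable_geometric_of_lt_one (hy0 j).le (hy1 j hj)).sum_le_tsum _
      fun k _ => pow_nonneg (hy0 j).le _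
  refine hgeom.trans ?_
  rw [Finset.prod_inv_distrib, ← inv_div]
  exact inv_anti₀ (div_pos (by linarith) (by linarith)) hprod

/-- Replacing parts of size `t` by one of size `c * t` costs `c - 1` parts, so the summand is
`q^(n/t)` times a product of powers of `q⁻¹`. The multiplicity of the part `t` is determined by the
others, which then range freely and give geometric series. -/
theorem sum_shapes_dvd_le (D n t : ℕ) (ht : 0 < t) (q : ℝ) (hq : 3 ≤ q) :
    ∑ m ∈ (shapes D n).filter (fun m => ∀ j : Fin D, m j ≠ 0 → t ∣ (j : ℕ) + 1), q ^ (∑ j, m j) ≤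
      q ^ (n / t) * ((q - 1) / (q - 2)) := by
  classical
  have hq0 : q ≠ 0 := by linarith
  let J : Finset (Fin D) := Finset.univ.filter fun j : Fin D => t ∣ (j : ℕ) + 1 ∧ (j : ℕ) + 1 ≠ t
  let w : Fin D → ℕ := fun j => ((j : ℕ) + 1) / t - 1
  let S := (shapes D n).filter (fun m => ∀ j : Fin D, m j ≠ 0 → t ∣ (j : ℕ) + 1)
  let r : (Fin D → ℕ) → (Fin D → ℕ) := fun m j => if j ∈ J then m j else 0
  have hS : ∀ m ∈ S, ∑ j : Fin D, ((j : ℕ) + 1) * m j = n ∧ ∀ j : Fin D, m j ≠ 0 → t ∣ (j : ℕ) + 1 := fun m hm => by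
    rw [Finset.mem_filter, mem_shapes] at hm
    exact hm
  have hdiv : ∀ m ∈ S, ∑ j : Fin D, (((j : ℕ) + 1) / t) * m j = n / t := fun m hm => by
    obtain ⟨h1, h2⟩ := hS m hm
    refine (Nat.div_eq_of_eq_mul_left ht ?_).symm
    rw [← h1, Finset.sum_mul]
    refine Finset.sum_congr rfl fun j _ => ?_
    by_cases h : m j = 0
    · simp [h]
    · rw [mul_right_comm, Nat.div_mul_cancel (h2 j h)]
  have hJ : ∀ m ∈ S, ∀ j : Fin D, j ∉ J → m j ≠ 0 → (j : ℕ) + 1 = t := fun m hm j hj hmj => by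
    by_contra hne
    exact hj (Finset.mem_filter.2 ⟨Finset.mem_univ _, (hS m hm).2 j hmj, hne⟩)
  have hval : ∀ m ∈ S, q ^ (∑ j, m j) = q ^ (n / t) * ∏ j ∈ J, ((q⁻¹) ^ w j) ^ (m j) := by
    intro m hm
    have h1 : ∑ j, m j + ∑ j ∈ J, w j * m j = n / t := by
      rw [← hdiv m hm, ← Finset.sum_filter_add_sum_filter_not Finset.univ (· ∈ J) m,
        ← Finset.sum_filter_add_sum_filter_not Finset.univ (· ∈ J)
          (fun j => (((j : ℕ) + 1) / t) * m j), Finset.filter_univ_mem]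
      rw [add_right_comm, ← Finset.sum_add_distrib]
      congr 1
      · refine Finset.sum_congr rfl fun j hj => ?_
        have : 1 ≤ ((j : ℕ) + 1) / t :=
          Nat.div_pos (Nat.le_of_dvd (Nat.succ_pos _) (Finset.mem_filter.1 hj).2.1) ht
        simp only [w]
        obtain ⟨a, ha⟩ := Nat.exists_eq_add_of_le this
        rw [ha]
        simp only [Nat.add_sub_cancel_left]
        ring
      · refine Finset.sum_congr rfl fun j hj => ?_
        by_cases h : m j = 0
        · simp [h]
        · rw [hJ m hm j (Finset.mem_filter.1 hj).2 h, Nat.div_self ht, one_mul]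
    simp_rw [← pow_mul]
    rw [Finset.prod_pow_eq_pow_sum, ← h1, pow_add, mul_assoc, ← mul_pow, mul_inv_cancel₀ hq0,
      one_pow, mul_one]
  have hinjr : Set.InjOn r S := by
    intro m hm m' hm' h
    have hJeq : ∀ j ∈ J, m j = m' j := fun j hj => by
      have := congrFun h j
      simpa [r, hj] using this
    funext j
    by_cases hj : j ∈ J
    · exact hJeq j hj
    by_cases hjt : (j : ℕ) + 1 = t
    · have h1 := (hS m hm).1
      rw [← (hS m' hm').1, Fintype.sum_eq_add_sum_compl j, Fintype.sum_eq_add_sum_compl j,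
        Finset.sum_congr rfl (g := fun i : Fin D => ((i : ℕ) + 1) * m' i)] at h1
      · exact Nat.eq_of_mul_eq_mul_left (Nat.succ_pos _) (Nat.add_right_cancel h1)
      · intro i hi
        congr 1
        by_cases hiJ : i ∈ J
        · exact hJeq i hiJ
        · have hne : (i : ℕ) + 1 ≠ t := fun h => by
            rw [Finset.mem_compl, Finset.mem_singleton] at hi
            exact hi (Fin.ext (by omega))
          have e1 : m i = 0 := by_contra fun h => hne (hJ m hm i hiJ h)
          have e2 : m' i = 0 := by_contra fun h => hne (hJ m' hm' i hiJ h)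
          rw [e1, e2]
    · have e1 : m j = 0 := by_contra fun h => hjt (hJ m hm j hj h)
      have e2 : m' j = 0 := by_contra fun h => hjt (hJ m' hm' j hj h)
      rw [e1, e2]
  have hy : ∀ j k, 0 ≤ ((q⁻¹) ^ w j) ^ k := fun j k =>
    pow_nonneg (pow_nonneg (inv_nonneg.2 (by linarith)) _) _
  change ∑ m ∈ S, q ^ (∑ j, m j) ≤ _
  rw [Finset.sum_congr rfl hval, ← Finset.mul_sum]
  refine mul_le_mul_of_nonneg_left ?_ (pow_nonneg (by linarith) _)
  calc ∑ m ∈ S, ∏ j ∈ J, ((q⁻¹) ^ w j) ^ (m j)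
      = ∑ m ∈ S, ∏ j, ((q⁻¹) ^ w j) ^ (r m j) := by
        refine Finset.sum_congr rfl fun m _ => ?_
        rw [← Finset.prod_subset (Finset.subset_univ J)]
        · exact Finset.prod_congr rfl fun j hj => by simp [r, hj]
        · intro j _ hj
          simp [r, hj]
    _ = ∑ m ∈ S.image r, ∏ j, ((q⁻¹) ^ w j) ^ (m j) := by rw [Finset.sum_image hinjr]
    _ ≤ ∑ m ∈ Fintype.piFinset (fun j => if j ∈ J then Finset.range (n + 1) else {0}),
          ∏ j, ((q⁻¹) ^ w j) ^ (m j) := by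
        refine Finset.sum_le_sum_of_subset_of_nonneg ?_ fun m _ _ =>
          Finset.prod_nonneg fun j _ => hy j _
        intro m' hm'
        obtain ⟨m, hm, rfl⟩ := Finset.mem_image.1 hm'
        rw [Fintype.mem_piFinset]
        intro j
        by_cases hj : j ∈ J
        · simp only [r, hj, if_true]
          exact Fintype.mem_piFinset.1 (Finset.mem_filter.1 (Finset.mem_filter.1 hm).1).1 j
        · simp [r, hj]
    _ = ∏ j, ∑ k ∈ (if j ∈ J then Finset.range (n + 1) else {0}), ((q⁻¹) ^ w j) ^ k :=
        (Finset.prod_univ_sum _ fun j k => ((q⁻¹) ^ w j) ^ k).symm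
    _ = ∏ j ∈ J, ∑ k ∈ Finset.range (n + 1), ((q⁻¹) ^ w j) ^ k := by
        rw [← Finset.prod_subset (Finset.subset_univ J)]
        · exact Finset.prod_congr rfl fun j hj => by simp [hj]
        · intro j _ hj
          simp [hj]
    _ ≤ (q - 1) / (q - 2) := by
        refine prod_geom_sum_le q hq J w (fun j hj => ?_) (fun i hi j hj hij => ?_) _
        · obtain ⟨-, ⟨c, hc⟩, hne⟩ := Finset.mem_filter.1 hj
          have : c ≠ 0 := by rintro rfl; omega
          have : c ≠ 1 := by rintro rfl; omega
          simp only [w]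
          rw [hc, Nat.mul_div_cancel_left _ ht]
          omega
        · obtain ⟨-, ⟨c, hc⟩, hne⟩ := Finset.mem_filter.1 hi
          obtain ⟨-, ⟨c', hc'⟩, hne'⟩ := Finset.mem_filter.1 hj
          have : c ≠ 0 := by rintro rfl; omega
          have : c' ≠ 0 := by rintro rfl; omega
          simp only [w] at hij
          rw [hc, hc', Nat.mul_div_cancel_left _ ht, Nat.mul_div_cancel_left _ ht] at hij
          have : c = c' := by omega
          subst this
          exact Fin.ext (by omega)

/-- For each `m`, either `τ m ≤ 1`, or `τ m` is one of the divisors `t ≥ 2` of `n` that divide all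
parts. Summing over all these `t` reduces to the preceding estimate. -/
theorem sum_shapes_sq_le (D n : ℕ) (hn : 0 < n) (q : ℝ) (hq : 3 ≤ q) (τ : (Fin D → ℕ) → ℕ)
    (hτ : ∀ m ∈ shapes D n, ∀ j : Fin D, m j ≠ 0 → τ m ∣ (j : ℕ) + 1) :
    ∑ m ∈ shapes D n, (τ m : ℝ) ^ 2 * q ^ (∑ j, m j) ≤
      ((q - 1) / (q - 2)) *
        (q ^ n + ∑ t ∈ (Finset.Icc 2 n).filter (· ∣ n), (t : ℝ) ^ 2 * q ^ (n / t)) := by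
  classical
  have hdvd : ∀ m ∈ shapes D n, ∀ t, (∀ j : Fin D, m j ≠ 0 → t ∣ (j : ℕ) + 1) → t ∣ n := by
    intro m hm t ht
    rw [← mem_shapes.1 hm]
    refine Finset.dvd_sum fun j _ => ?_
    by_cases h : m j = 0
    · simp [h]
    · exact (ht j h).mul_right _
  have h1 : ∀ m ∈ shapes D n, (τ m : ℝ) ^ 2 * q ^ (∑ j, m j) ≤ q ^ (∑ j, m j) +
      ∑ t ∈ (Finset.Icc 2 n).filter (· ∣ n),
        if ∀ j : Fin D, m j ≠ 0 → t ∣ (j : ℕ) + 1 then (t : ℝ) ^ 2 * q ^ (∑ j, m j) else 0 := by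
    intro m hm
    have hpos : 0 ≤ q ^ (∑ j, m j) := pow_nonneg (by linarith) _
    have hnn : ∀ t ∈ (Finset.Icc 2 n).filter (· ∣ n),
        0 ≤ if ∀ j : Fin D, m j ≠ 0 → t ∣ (j : ℕ) + 1 then (t : ℝ) ^ 2 * q ^ (∑ j, m j) else 0 :=
      fun t _ => by split_ifs <;> positivity
    have hτn := hdvd m hm _ (hτ m hm)
    rcases Nat.lt_or_ge (τ m) 2 with h | h
    · have hle : (τ m : ℝ) ^ 2 ≤ 1 := by
        have : (τ m : ℝ) ≤ 1 := by exact_mod_cast Nat.lt_succ_iff.1 h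
        exact pow_le_one₀ (Nat.cast_nonneg _) this
      have := Finset.sum_nonneg hnn
      nlinarith
    · have := Finset.single_le_sum hnn (Finset.mem_filter.2
        ⟨Finset.mem_Icc.2 ⟨h, Nat.le_of_dvd hn hτn⟩, hτn⟩)
      rw [if_pos (hτ m hm)] at this
      linarith
  refine (Finset.sum_le_sum h1).trans ?_
  rw [Finset.sum_add_distrib, mul_add, Finset.sum_comm, Finset.mul_sum]
  refine add_le_add ?_ (Finset.sum_le_sum fun t ht => ?_)
  · have := sum_shapes_dvd_le D n 1 one_pos q hq
    rw [Finset.filter_true_of_mem fun m _ j _ => one_dvd _, Nat.div_one] at this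
    linarith
  · have h2 : 0 < t := by
      have := (Finset.mem_Icc.1 (Finset.mem_filter.1 ht).1).1
      omega
    have := sum_shapes_dvd_le D n t h2 q hq
    rw [← Finset.sum_filter, ← Finset.mul_sum]
    calc _ ≤ (t : ℝ) ^ 2 * (q ^ (n / t) * ((q - 1) / (q - 2))) :=
          mul_le_mul_of_nonneg_left this (by positivity)
      _ = _ := by ring

theorem sum_divisor_sq_le (n : ℕ) (hn : 3 ≤ n) (q : ℝ) (hq : 11 ≤ q) :
    ∑ t ∈ (Finset.Icc 2 n).filter (· ∣ n), (t : ℝ) ^ 2 * q ^ (n / t) ≤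
      15 / 11 * q ^ (n - 1) := by
  -- For `t ≥ 3` the weights come from `t^2 ≤ 9 * 2^(t-3)` and `n/t + (t-2) ≤ n-1`; the full series
  -- sums to `4/11 + 1 = 15/11`.
  let b : ℕ → ℝ := fun t => if t = 2 then 4 / 11 else 9 / 11 * (2 / 11) ^ (t - 3)
  have hb : ∀ t, 0 ≤ b t := fun t => by
    simp only [b]
    split_ifs <;> positivity
  have hq0 : 0 < q := by linarith
  have hsum : ∀ n, 2 ≤ n → ∑ t ∈ Finset.Icc 2 n, b t = 15 / 11 - (2 / 11) ^ (n - 2) := by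
    intro n hn
    induction n, hn using Nat.le_induction with
    | base => norm_num [b]
    | succ n hn ih =>
      rw [← Finset.insert_Icc_right_eq_Icc_add_one (by omega), Finset.sum_insert (by simp), ih]
      obtain ⟨k, rfl⟩ := Nat.exists_eq_add_of_le hn
      have h2 : (2 + k + 1) ≠ 2 := by omega
      simp only [b, if_neg h2]
      rw [show 2 + k + 1 - 3 = k by omega, show 2 + k + 1 - 2 = k + 1 by omega,
        show 2 + k - 2 = k by omega, pow_succ]
      ring
  have hsq : ∀ t : ℕ, 3 ≤ t → (t : ℝ) ^ 2 ≤ 9 * 2 ^ (t - 3) := by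
    intro t ht
    induction t, ht using Nat.le_induction with
    | base => norm_num
    | succ t ht ih =>
      have ht' : (3 : ℝ) ≤ t := by exact_mod_cast ht
      have h1 : (9 * 2 ^ (t + 1 - 3) : ℝ) = 2 * (9 * 2 ^ (t - 3)) := by
        rw [show t + 1 - 3 = (t - 3) + 1 by omega, pow_succ]
        ring
      rw [h1]
      push_cast
      nlinarith
  have hterm : ∀ t ∈ (Finset.Icc 2 n).filter (· ∣ n),
      (t : ℝ) ^ 2 * q ^ (n / t) ≤ b t * q ^ (n - 1) := by
    intro t ht
    obtain ⟨ht1, s, rfl⟩ := Finset.mem_filter.1 ht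
    have ht2 := (Finset.mem_Icc.1 ht1).1
    have hs : s ≠ 0 := by rintro rfl; omega
    rw [Nat.mul_div_cancel_left _ (by omega)]
    rcases Nat.lt_or_ge t 3 with h | h
    · obtain rfl : t = 2 := by omega
      obtain ⟨k, rfl⟩ : ∃ k, s = k + 2 := ⟨s - 2, by omega⟩
      rw [show 2 * (k + 2) - 1 = (k + 2) + (k + 1) by omega, pow_add q (k + 2)]
      have h1 : 11 ≤ q ^ (k + 1) := by
        rw [pow_succ]
        have : 1 ≤ q ^ k := one_le_pow₀ (by linarith)
        nlinarith
      have h2 : 0 < q ^ (k + 2) := pow_pos hq0 _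
      simp only [b, if_true]
      push_cast
      nlinarith
    · have h2 : t ≠ 2 := by omega
      simp only [b, if_neg h2]
      have h3 : q ^ s * 11 ^ (t - 2) ≤ q ^ (t * s - 1) := by
        have h4 : s + (t - 2) ≤ t * s - 1 := by
          obtain ⟨k, rfl⟩ : ∃ k, s = k + 1 := ⟨s - 1, by omega⟩
          obtain ⟨l, rfl⟩ : ∃ l, t = l + 3 := ⟨t - 3, by omega⟩
          have : (l + 3) * (k + 1) = l * k + l + 3 * k + 3 := by ring
          rw [this]
          have := Nat.zero_le (l * k)
          omega
        calc q ^ s * 11 ^ (t - 2) ≤ q ^ s * q ^ (t - 2) :=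
              mul_le_mul_of_nonneg_left (pow_le_pow_left₀ (by norm_num) hq _) (by positivity)
          _ = q ^ (s + (t - 2)) := (pow_add _ _ _).symm
          _ ≤ _ := pow_le_pow_right₀ (by linarith) h4
      have h5 := hsq t h
      have h6 : (9 / 11 * (2 / 11) ^ (t - 3) : ℝ) * (q ^ s * 11 ^ (t - 2)) =
          (9 * 2 ^ (t - 3)) * q ^ s := by
        rw [show t - 2 = (t - 3) + 1 by omega, pow_succ, div_pow]
        field_simp
      calc (t : ℝ) ^ 2 * q ^ s ≤ (9 * 2 ^ (t - 3)) * q ^ s :=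
            mul_le_mul_of_nonneg_right h5 (by positivity)
        _ = _ := h6.symm
        _ ≤ _ := mul_le_mul_of_nonneg_left h3 (by positivity)
  refine (Finset.sum_le_sum hterm).trans ?_
  rw [← Finset.sum_mul]
  refine mul_le_mul_of_nonneg_right ?_ (by positivity)
  refine (Finset.sum_le_sum_of_subset_of_nonneg (Finset.filter_subset _ _)
    fun t _ _ => hb t).trans ?_
  rw [hsum n (by omega)]
  have : (0 : ℝ) < (2 / 11) ^ (n - 2) := by positivity
  linarith

theorem sum_shapes_sq_le_of_three_le (D n : ℕ) (hn : 3 ≤ n) (q : ℝ) (hq : 11 ≤ q)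
    (τ : (Fin D → ℕ) → ℕ) (hτ : ∀ m ∈ shapes D n, ∀ j : Fin D, m j ≠ 0 → τ m ∣ (j : ℕ) + 1) :
    ∑ m ∈ shapes D n, (τ m : ℝ) ^ 2 * q ^ (∑ j, m j) ≤ q ^ n + 3 * q ^ (n - 1) := by
  refine (sum_shapes_sq_le D n (by omega) q (by linarith) τ hτ).trans ?_
  have h1 := sum_divisor_sq_le n hn q hq
  have hp : q ^ n = q * q ^ (n - 1) := by
    rw [← pow_succ']; congr 1; omega
  have hpos : 0 < q ^ (n - 1) := pow_pos (by linarith) _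
  rw [div_mul_eq_mul_div, div_le_iff₀ (by linarith), hp]
  rw [hp] at *
  nlinarith [mul_le_mul_of_nonneg_left h1 (show 0 ≤ q - 1 by linarith)]

/-- A cruder form, valid also for `n = 1, 2`, which is enough for the nontrivial scalars. -/
theorem sum_shapes_sq_le_two_mul (D n : ℕ) (hn : 0 < n) (q : ℝ) (hq : 11 ≤ q)
    (τ : (Fin D → ℕ) → ℕ) (hτ : ∀ m ∈ shapes D n, ∀ j : Fin D, m j ≠ 0 → τ m ∣ (j : ℕ) + 1) :
    ∑ m ∈ shapes D n, (τ m : ℝ) ^ 2 * q ^ (∑ j, m j) ≤ 2 * q ^ n := by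
  rcases Nat.lt_or_ge n 3 with h | h
  · refine (sum_shapes_sq_le D n hn q (by linarith) τ hτ).trans ?_
    rw [div_mul_eq_mul_div, div_le_iff₀ (by linarith)]
    interval_cases n
    · simp
      nlinarith
    · rw [show (Finset.Icc 2 2).filter (· ∣ 2) = {2} from rfl]
      simp
      nlinarith
  · refine (sum_shapes_sq_le_of_three_le D n h q hq τ hτ).trans ?_
    have hp : q ^ n = q * q ^ (n - 1) := by
      rw [← pow_succ']; congr 1; omega
    have hpos : 0 < q ^ (n - 1) := pow_pos (by linarith) _
    rw [hp]
    nlinarith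

end Shapes

/-! ### Counting the types fixed by a scalar -/

section TypeCount

open Polynomial Matrix

universe u

variable {F : Type u} [Field F] {d : ℕ}

/-- The tuples of units that are trivial outside of `S`. -/
def unitTuples (F : Type*) [Field F] (S : Finset (Fin d)) : Subgroup (Fin d → Fˣ) where
  carrier := {c | ∀ j, j ∉ S → c j = 1}
  one_mem' := fun _ _ => rfl
  mul_mem' := fun ha hb j hj => by rw [Pi.mul_apply, ha j hj, hb j hj, one_mul]
  inv_mem' := fun ha j hj => by rw [Pi.inv_apply, ha j hj, inv_one]

/-- The homomorphism `c ↦ ∏ c_j ^ (j + 1)`. -/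
def weightHom (F : Type*) [Field F] (d : ℕ) : (Fin d → Fˣ) →* Fˣ where
  toFun c := ∏ j : Fin d, c j ^ ((j : ℕ) + 1)
  map_one' := by simp
  map_mul' a b := by simp [mul_pow, Finset.prod_mul_distrib]

/-- The group of determinants of the elements that commute with a matrix in whose type the
nontrivial entries are those in `S`. -/
def detSubgroup (F : Type*) [Field F] (S : Finset (Fin d)) : Subgroup Fˣ :=
  (unitTuples F S).map (weightHom F d)

/-- Varying the coordinate `j` alone already yields all `(j+1)`-st powers, a subgroup of the cyclic
group `Fˣ` whose index divides `j + 1`. -/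
theorem detSubgroup_index_dvd [Finite F] (S : Finset (Fin d)) (j : Fin d) (hj : j ∈ S) :
    (detSubgroup F S).index ∣ (j : ℕ) + 1 := by
  have h1 : (powMonoidHom ((j : ℕ) + 1) : Fˣ →* Fˣ).range ≤ detSubgroup F S := by
    rintro _ ⟨a, rfl⟩
    have hne : ∀ i, i ≠ j → (Pi.mulSingle j a : Fin d → Fˣ) i = 1 := fun i hi =>
      Pi.mulSingle_eq_of_ne (M := fun _ => Fˣ) hi a
    refine ⟨Pi.mulSingle j a, fun i hi => hne i ?_, ?_⟩
    · rintro rfl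
      exact hi hj
    · change ∏ i : Fin d, _ = _
      rw [Finset.prod_eq_single j]
      · simp
      · intro i _ hi
        rw [hne i hi, one_pow]
      · simp
  have h2 := Subgroup.index_dvd_of_le h1
  rw [IsCyclic.index_powMonoidHom_range] at h2
  exact h2.trans (Nat.gcd_dvd_right _ _)

theorem card_unitTuples [Fintype F] (S : Finset (Fin d)) :
    Nat.card (unitTuples F S) = (Fintype.card F - 1) ^ S.card := by
  classical
  let e : unitTuples F S ≃ (S → Fˣ) :=
    { toFun := fun c j => c.1 j
      invFun := fun c => ⟨fun j => if h : j ∈ S then c ⟨j, h⟩ else 1, fun j hj => dif_neg hj⟩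
      left_inv := fun c => Subtype.ext <| funext fun j => by
        by_cases h : j ∈ S
        · simp [h]
        · simp [h, c.2 j h]
      right_inv := fun c => funext fun j => by simp }
  rw [Nat.card_congr e, Nat.card_fun, Nat.card_eq_fintype_card, Nat.card_eq_fintype_card,
    Fintype.card_units, Fintype.card_coe]

theorem card_weightHom_fiber_mul_le [Fintype F] (S : Finset (Fin d)) (a : Fˣ) :
    Nat.card {c : unitTuples F S // weightHom F d c = a} * (Fintype.card F - 1) ≤
      (Fintype.card F - 1) ^ S.card * (detSubgroup F S).index := by
  classical
  let f : unitTuples F S →* Fˣ := (weightHom F d).comp (unitTuples F S).subtype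
  have hrange : f.range = detSubgroup F S := by
    rw [MonoidHom.range_comp, Subgroup.range_subtype]
    rfl
  have h1 : Nat.card {c : unitTuples F S // weightHom F d c = a} ≤ Nat.card f.ker := by
    rcases isEmpty_or_nonempty {c : unitTuples F S // weightHom F d c = a} with h | ⟨⟨c₀, hc₀⟩⟩
    · simp
    · refine Nat.card_le_card_of_injective (fun c => ⟨c.1 * c₀⁻¹, ?_⟩) fun c c' h => ?_
      · rw [MonoidHom.mem_ker, map_mul, map_inv]
        change weightHom F d c.1 * (weightHom F d c₀)⁻¹ = 1
        rw [c.2, hc₀, mul_inv_cancel]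
      · exact Subtype.ext (mul_right_cancel (Subtype.mk.inj h))
  have h2 := Subgroup.card_mul_index f.ker
  rw [Subgroup.index_ker, hrange, card_unitTuples] at h2
  have h3 := Subgroup.card_mul_index (detSubgroup F S)
  rw [Nat.card_eq_fintype_card (α := Fˣ), Fintype.card_units] at h3
  rw [← h2, ← h3, ← mul_assoc]
  exact Nat.mul_le_mul_right _ (Nat.mul_le_mul_right _ h1)

/-- The possible types of matrices of determinant `1`. -/
def typeSet (F : Type u) [Field F] (d : ℕ) : Set (Fin d → F[X]) :=
  {g | (∀ j, (g j).Monic) ∧ ∑ j : Fin d, ((j : ℕ) + 1) * (g j).natDegree = d ∧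
    ∏ j : Fin d, ((-1) ^ (g j).natDegree * (g j).coeff 0) ^ ((j : ℕ) + 1) = 1}

theorem typeSet_finite [Finite F] : (typeSet F d).Finite := by
  have hfin : Finite (degreeLT F (d + 1)) :=
    Finite.of_equiv _ (degreeLTEquiv F (d + 1)).symm.toEquiv
  have hfin' : (degreeLT F (d + 1) : Set F[X]).Finite := hfin
  refine Set.Finite.subset (Set.Finite.pi' fun _ : Fin d => hfin') fun g hg j => ?_
  have h1 : ((j : ℕ) + 1) * (g j).natDegree ≤ d := by
    conv_rhs => rw [← hg.2.1]
    exact Finset.single_le_sum (f := fun j : Fin d => ((j : ℕ) + 1) * (g j).natDegree)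
      (fun _ _ => Nat.zero_le _) (Finset.mem_univ j)
  have h2 : (g j).natDegree ≤ d := (Nat.le_mul_of_pos_left _ (Nat.succ_pos _)).trans h1
  rw [SetLike.mem_coe, mem_degreeLT]
  exact degree_le_natDegree.trans_lt (by exact_mod_cast Nat.lt_succ_of_le h2)

/-- The support of a type. -/
def typeSupport (g : Fin d → F[X]) : Finset (Fin d) :=
  Finset.univ.filter fun j => (g j).natDegree ≠ 0

/-- The number of classes of `SL` which may have the type `g`. -/
noncomputable def typeWeight (g : Fin d → F[X]) : ℕ := (detSubgroup F (typeSupport g)).index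

theorem coeff_zero_ne_zero_of_mem_typeSet {g : Fin d → F[X]} (hg : g ∈ typeSet F d) (j : Fin d) :
    (g j).coeff 0 ≠ 0 := by
  intro h
  have h1 := hg.2.2
  rw [Finset.prod_eq_zero (Finset.mem_univ j)] at h1
  · exact zero_ne_one h1
  · rw [h, mul_zero, zero_pow (Nat.succ_ne_zero _)]

/-- Scaling multiplies the coefficient of `X^k` by `ζ` to the power `natDegree - k`, so a fixed
polynomial with nonzero constant term is a polynomial in `X^(orderOf ζ)`. -/
theorem scaleRoots_coeff_ne_zero {f : F[X]} {ζ : Fˣ} (h : f.scaleRoots ζ = f) {k : ℕ}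
    (hk : f.coeff k ≠ 0) : orderOf ζ ∣ f.natDegree - k := by
  have h1 := congrArg (fun t => t.coeff k) h
  simp only [coeff_scaleRoots] at h1
  rw [orderOf_dvd_iff_pow_eq_one]
  ext
  rw [Units.val_pow_eq_pow_val, Units.val_one]
  exact (mul_eq_left₀ hk).1 h1

/-- Group the fixed types by `m j = deg (g j) / orderOf ζ`. The determinant condition confines the
constant terms to a fibre of `weightHom`, which saves a factor of about `q` and costs the index `t`.
The weight of the type is again `t`, hence the square. -/
theorem sum_typeWeight_le [Fintype F] (hd : 0 < d) (ζ : Fˣ) (hζ : ζ ^ d = 1)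
    (D : Finset (Fin d → F[X]))
    (hD : ∀ g ∈ D, g ∈ typeSet F d ∧ ∀ j, (g j).scaleRoots ζ = g j) :
    ∃ τ : (Fin d → ℕ) → ℕ,
      (∀ m ∈ shapes d (d / orderOf ζ), ∀ j : Fin d, m j ≠ 0 → τ m ∣ (j : ℕ) + 1) ∧
      (Fintype.card F : ℝ) * ∑ g ∈ D, (typeWeight g : ℝ) ≤
        ∑ m ∈ shapes d (d / orderOf ζ), (τ m : ℝ) ^ 2 * (Fintype.card F : ℝ) ^ (∑ j, m j) := by
  classical
  set o := orderOf ζ with ho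
  have hopos : 0 < o := orderOf_pos ζ
  let supp : (Fin d → ℕ) → Finset (Fin d) := fun m => Finset.univ.filter fun j => m j ≠ 0
  refine ⟨fun m => (detSubgroup F (supp m)).index, fun m _ j hj =>
    detSubgroup_index_dvd _ j (Finset.mem_filter.2 ⟨Finset.mem_univ _, hj⟩), ?_⟩
  let sh : (Fin d → F[X]) → (Fin d → ℕ) := fun g j => (g j).natDegree / o
  have hdeg : ∀ g ∈ D, ∀ j, (g j).natDegree = o * sh g j := fun g hg j => by
    have := scaleRoots_coeff_ne_zero ((hD g hg).2 j)
      (coeff_zero_ne_zero_of_mem_typeSet (hD g hg).1 j)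
    exact (Nat.mul_div_cancel' this).symm
  have hsupp : ∀ g ∈ D, typeSupport g = supp (sh g) := fun g hg => by
    ext j
    simp only [typeSupport, supp, Finset.mem_filter, Finset.mem_univ, true_and, hdeg g hg j]
    simp [hopos.ne']
  have hsh : ∀ g ∈ D, sh g ∈ shapes d (d / o) := fun g hg => by
    rw [mem_shapes]
    refine (Nat.div_eq_of_eq_mul_left hopos ?_).symm
    refine (hD g hg).1.2.1.symm.trans ?_
    rw [Finset.sum_mul]
    refine Finset.sum_congr rfl fun j _ => ?_
    rw [hdeg g hg j]
    ring
  rw [← Finset.sum_fiberwise_of_maps_to hsh, Finset.mul_sum]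
  refine Finset.sum_le_sum fun m hm => ?_
  set S := supp m with hS
  set q := Fintype.card F with hq
  have hq1 : 1 < q := Fintype.one_lt_card
  set E := D.filter fun g => sh g = m with hE
  have hEm : ∀ g ∈ E, g ∈ D ∧ sh g = m := fun g hg => Finset.mem_filter.1 hg
  have hSpos : S.Nonempty := by
    rw [Finset.nonempty_iff_ne_empty]
    intro h
    have h0 : ∀ j, m j = 0 := fun j => by
      by_contra hj
      have : j ∈ S := Finset.mem_filter.2 ⟨Finset.mem_univ _, hj⟩
      rw [h] at this
      exact absurd this (Finset.notMem_empty j)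
    have h1 := mem_shapes.1 hm
    simp only [h0, mul_zero, Finset.sum_const_zero] at h1
    have : o ∣ d := orderOf_dvd_of_pow_eq_one hζ
    exact (Nat.div_pos (Nat.le_of_dvd hd this) hopos).ne h1
  -- the constant terms and the remaining coefficients determine `g`
  let a : Fˣ := ∏ j : Fin d, ((-1 : Fˣ) ^ (o * m j)) ^ ((j : ℕ) + 1)
  have hcoef : ∀ g : E, ∀ j, (g.1 j).coeff 0 ≠ 0 := fun g =>
    coeff_zero_ne_zero_of_mem_typeSet (hD g.1 (hEm g.1 g.2).1).1
  have hnd : ∀ g : E, ∀ j, (g.1 j).natDegree = o * m j := fun g j => by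
    rw [hdeg g.1 (hEm g.1 g.2).1 j, (hEm g.1 g.2).2]
  let c : E → (Fin d → Fˣ) := fun g j => Units.mk0 ((g.1 j).coeff 0) (hcoef g j)
  have hc : ∀ g : E, c g ∈ unitTuples F S := fun g j hj => by
    have hj0 : m j = 0 := by
      by_contra h
      exact hj (Finset.mem_filter.2 ⟨Finset.mem_univ _, h⟩)
    have h1 := hnd g j
    rw [hj0, mul_zero] at h1
    have h2 := (hD g.1 (hEm g.1 g.2).1).1.1 j
    ext
    change (g.1 j).coeff 0 = 1
    rw [← h1]
    exact h2
  -- Determinant `1`, with the signs collected in `a`.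
  have hca : ∀ g : E, weightHom F d (c g) = a⁻¹ := fun g => by
    rw [eq_inv_iff_mul_eq_one, mul_comm]
    change (∏ j : Fin d, _) * (∏ j : Fin d, _) = _
    rw [← Finset.prod_mul_distrib]
    ext
    rw [Units.coe_prod, Units.val_one, ← (hD g.1 (hEm g.1 g.2).1).1.2.2]
    refine Finset.prod_congr rfl fun j _ => ?_
    rw [← mul_pow, hnd g j]
    simp [c]
  let Φ : E → {c : unitTuples F S // weightHom F d c = a⁻¹} × (Π j : Fin d, Fin (m j - 1) → F) :=
    fun g => (⟨⟨c g, hc g⟩, hca g⟩, fun j i => (g.1 j).coeff (((i : ℕ) + 1) * o))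
  have hΦ : Function.Injective Φ := by
    intro g g' h
    have h1 : ∀ j, (g.1 j).coeff 0 = (g'.1 j).coeff 0 := fun j =>
      congrArg (fun t => ((t.1.1.1 j : Fˣ) : F)) h
    have h2 : ∀ j (i : Fin (m j - 1)), (g.1 j).coeff (((i : ℕ) + 1) * o) =
        (g'.1 j).coeff (((i : ℕ) + 1) * o) := fun j i => congrArg (fun t => t.2 j i) h
    refine Subtype.ext (funext fun j => ?_)
    ext k
    rcases lt_trichotomy k (o * m j) with hk | hk | hk
    · by_cases hdv : o ∣ k
      · obtain ⟨l, rfl⟩ := hdv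
        rcases Nat.eq_zero_or_pos l with rfl | hl
        · exact h1 j
        · have hlm : l < m j := lt_of_mul_lt_mul_left hk (Nat.zero_le o)
          have := h2 j ⟨l - 1, by omega⟩
          rwa [Fin.val_mk, Nat.sub_add_cancel hl, mul_comm] at this
      · have hz : ∀ g : E, (g.1 j).coeff k = 0 := fun g => by
          by_contra hne
          have h3 := scaleRoots_coeff_ne_zero ((hD g.1 (hEm g.1 g.2).1).2 j) hne
          rw [hnd g j] at h3
          exact hdv ((Nat.dvd_sub_iff_right hk.le (dvd_mul_right _ _)).1 h3)
        rw [hz, hz]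
    · have h3 : ∀ g : E, (g.1 j).coeff k = 1 := fun g => by
        rw [hk, ← hnd g j]
        exact (hD g.1 (hEm g.1 g.2).1).1.1 j
      rw [h3, h3]
    · rw [coeff_eq_zero_of_natDegree_lt (by rwa [hnd g j]),
        coeff_eq_zero_of_natDegree_lt (by rwa [hnd g' j])]
  have hcard : E.card ≤ Nat.card {c : unitTuples F S // weightHom F d c = a⁻¹} *
      q ^ (∑ j, (m j - 1)) := by
    have := Nat.card_le_card_of_injective Φ hΦ
    rw [Nat.card_prod, Nat.card_pi, Nat.card_eq_fintype_card (α := E), Fintype.card_coe] at this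
    refine this.trans (Nat.mul_le_mul_left _ (le_of_eq ?_))
    rw [← Finset.prod_pow_eq_pow_sum]
    refine Finset.prod_congr rfl fun j _ => ?_
    rw [Nat.card_fun, Nat.card_eq_fintype_card, Nat.card_eq_fintype_card, Fintype.card_fin]
  have hfib := card_weightHom_fiber_mul_le S a⁻¹
  rw [← hq] at hfib
  set t := (detSubgroup F S).index with ht
  -- Truncated subtraction is intended: only `j` in the support has a constant term counted
  -- separately.
  have hexp : ∑ j, (m j - 1) + S.card = ∑ j, m j := by
    rw [hS, Finset.card_eq_sum_ones, Finset.sum_filter, ← Finset.sum_add_distrib]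
    refine Finset.sum_congr rfl fun j _ => ?_
    split_ifs <;> omega
  have hnat : q * E.card ≤ t * q ^ (∑ j, m j) := by
    obtain ⟨s, hs⟩ : ∃ s, S.card = s + 1 := ⟨S.card - 1, by have := hSpos.card_pos; omega⟩
    have h1 : E.card * (q - 1) ≤ ((q - 1) ^ s * (t * q ^ (∑ j, (m j - 1)))) * (q - 1) := by
      calc E.card * (q - 1) ≤ _ * q ^ (∑ j, (m j - 1)) * (q - 1) := Nat.mul_le_mul_right _ hcard
        _ = (_ * (q - 1)) * q ^ (∑ j, (m j - 1)) := by ring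
        _ ≤ ((q - 1) ^ S.card * t) * q ^ (∑ j, (m j - 1)) := Nat.mul_le_mul_right _ hfib
        _ = _ := by rw [hs, pow_succ]; ring
    have h2 := Nat.le_of_mul_le_mul_right h1 (by omega)
    calc q * E.card ≤ q * ((q - 1) ^ s * (t * q ^ (∑ j, (m j - 1)))) := Nat.mul_le_mul_left _ h2
      _ ≤ q * (q ^ s * (t * q ^ (∑ j, (m j - 1)))) := by
          gcongr
          omega
      _ = t * q ^ (∑ j, m j) := by rw [← hexp, hs]; ring
  have hw : ∀ g ∈ E, (typeWeight g : ℝ) = t := fun g hg => by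
    rw [typeWeight, hsupp g (hEm g hg).1, (hEm g hg).2]
  rw [Finset.sum_congr rfl hw, Finset.sum_const, nsmul_eq_mul, ← mul_assoc, sq, mul_comm,
    mul_assoc]
  refine mul_le_mul_of_nonneg_left ?_ (Nat.cast_nonneg _)
  exact_mod_cast hnat

end TypeCount

/-! ### From types to conjugacy classes -/

section ClassCount

open Polynomial Matrix

universe u

variable {F : Type u} [Field F] [Fintype F] {d : ℕ} {H : Type*} [Group H]

omit [Fintype F] in
theorem Matrix.IsTypeOf.mem_typeSet {x : SpecialLinearGroup (Fin d) F} {g : Fin d → F[X]}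
    (hx : (x : Matrix (Fin d) (Fin d) F).IsTypeOf g) : g ∈ typeSet F d :=
  ⟨hx.monic, hx.sum_natDegree, by rw [← hx.det_eq, x.det_coe]⟩

/-- Write representatives as `GL`-conjugates `h x₀ h⁻¹`. If two values of `det h` agree modulo
`detSubgroup`, an element commuting with `x₀` corrects the conjugator to determinant `1`; so the
coset of `det h` separates classes. -/
theorem card_conjClasses_isTypeOf_le (π : SpecialLinearGroup (Fin d) F →* H) (g : Fin d → F[X]) :
    Nat.card {c : ConjClasses H // ∃ x : SpecialLinearGroup (Fin d) F,
      (x : Matrix (Fin d) (Fin d) F).IsTypeOf g ∧ ConjClasses.mk (π x) = c} ≤ typeWeight g := by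
  classical
  rcases isEmpty_or_nonempty {c : ConjClasses H // ∃ x : SpecialLinearGroup (Fin d) F,
      (x : Matrix (Fin d) (Fin d) F).IsTypeOf g ∧ ConjClasses.mk (π x) = c} with h | ⟨⟨c₀, x₀, hx₀, -⟩⟩
  · simp
  have hex : ∀ c : {c : ConjClasses H // ∃ x : SpecialLinearGroup (Fin d) F,
      (x : Matrix (Fin d) (Fin d) F).IsTypeOf g ∧ ConjClasses.mk (π x) = c},
      ∃ (x : SpecialLinearGroup (Fin d) F) (h : GL (Fin d) F), ConjClasses.mk (π x) = c.1 ∧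
        (x : GL (Fin d) F) = h * (x₀ : GL (Fin d) F) * h⁻¹ := by
    rintro ⟨c, x, hx, hc⟩
    obtain ⟨h, hh⟩ := hx₀.exists_conj hx
    refine ⟨x, h, hc, ?_⟩
    rw [eq_mul_inv_iff_mul_eq]
    exact Units.ext hh.symm
  choose x h hxc hxh using hex
  refine Nat.card_le_card_of_injective
    (fun c => (QuotientGroup.mk (GeneralLinearGroup.det (h c)) :
      Fˣ ⧸ detSubgroup F (typeSupport g))) fun c c' hcc => ?_
  obtain ⟨b, hb, hbw⟩ := QuotientGroup.eq.1 hcc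
  obtain ⟨k, hk, hkdet⟩ := hx₀.exists_commute_det_eq b fun j hj => hb j fun hmem => by
    have := (Finset.mem_filter.1 hmem).2
    rw [hj, natDegree_one] at this
    exact this rfl
  have hkx : k * (x₀ : GL (Fin d) F) = x₀ * k := Units.ext hk
  have hkdet' : GeneralLinearGroup.det k =
      (GeneralLinearGroup.det (h c))⁻¹ * GeneralLinearGroup.det (h c') := hkdet.trans hbw
  let m : GL (Fin d) F := h c' * k⁻¹ * (h c)⁻¹
  have hm : GeneralLinearGroup.det m = 1 := by
    simp only [m, map_mul, map_inv, hkdet']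
    group
  let m' : SpecialLinearGroup (Fin d) F :=
    ⟨m, congrArg Units.val hm⟩
  have hm' : (m' : GL (Fin d) F) = m := Units.ext rfl
  have hconj : m' * x c * m'⁻¹ = x c' := by
    apply SpecialLinearGroup.toGL_injective
    rw [map_mul, map_mul, map_inv, hm', hxh, hxh]
    simp only [m]
    rw [mul_inv_eq_iff_eq_mul]
    calc h c' * k⁻¹ * (h c)⁻¹ * (h c * (x₀ : GL (Fin d) F) * (h c)⁻¹)
        = h c' * k⁻¹ * ((x₀ : GL (Fin d) F) * k) * k⁻¹ * (h c)⁻¹ := by group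
      _ = _ := by rw [← hkx]; group
  apply Subtype.ext
  rw [← hxc c, ← hxc c', ConjClasses.mk_eq_mk_iff_isConj, isConj_iff]
  exact ⟨π m', by rw [← hconj, map_mul, map_mul, map_inv]⟩

/-- A Burnside argument. All multiples by `W` of a type of a class `c` are types of `c`, so by orbit
and stabilizer `|W|` is at most the sum of `|Stab g|` over the types `g` of `c`. Sum over `c`,
exchange the sums, and bound the classes of each type by its weight. -/
theorem card_conjClasses_mul_card_le (π : SpecialLinearGroup (Fin d) F →* H)
    (hπ : Function.Surjective π) (W : Subgroup Fˣ) [Fintype W] (hW : ∀ ζ ∈ W, ζ ^ d = 1)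
    (hπW : ∀ ζ ∈ W, ∀ x y : SpecialLinearGroup (Fin d) F,
      (y : Matrix (Fin d) (Fin d) F) = (ζ : F) • (x : Matrix (Fin d) (Fin d) F) → π y = π x) :
    ∃ D : W → Finset (Fin d → F[X]),
      (∀ ζ, ∀ g ∈ D ζ, g ∈ typeSet F d ∧ ∀ j, (g j).scaleRoots (ζ : Fˣ) = g j) ∧
      Nat.card (ConjClasses H) * Nat.card W ≤ ∑ ζ : W, ∑ g ∈ D ζ, typeWeight g := by
  classical
  have : Finite H := Finite.of_surjective π hπ
  have := Fintype.ofFinite (ConjClasses H)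
  let D₀ : Finset (Fin d → F[X]) := (typeSet_finite (F := F) (d := d)).toFinset
  let act : W → (Fin d → F[X]) → (Fin d → F[X]) := fun ζ g j => (g j).scaleRoots (ζ : Fˣ)
  have hact : ∀ ζ ξ g, act ζ (act ξ g) = act (ξ * ζ) g := fun ζ ξ g => by
    ext1 j
    simp only [act]
    rw [← scaleRoots_mul]
    rfl
  refine ⟨fun ζ => D₀.filter fun g => act ζ g = g, fun ζ g hg => ?_, ?_⟩
  · obtain ⟨h1, h2⟩ := Finset.mem_filter.1 hg
    exact ⟨(typeSet_finite (F := F) (d := d)).mem_toFinset.1 h1, fun j => congrFun h2 j⟩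
  have hex : ∀ c : ConjClasses H, ∃ (x : SpecialLinearGroup (Fin d) F) (g : Fin d → F[X]),
      ConjClasses.mk (π x) = c ∧ (x : Matrix (Fin d) (Fin d) F).IsTypeOf g := fun c => by
    obtain ⟨y, rfl⟩ := ConjClasses.mk_surjective c
    obtain ⟨x, rfl⟩ := hπ y
    obtain ⟨g, hg⟩ := (x : Matrix (Fin d) (Fin d) F).exists_isTypeOf
    exact ⟨x, g, rfl, hg⟩
  choose x g hx hg using hex
  let P : (Fin d → F[X]) → ConjClasses H → Prop := fun g c =>
    ∃ x : SpecialLinearGroup (Fin d) F, (x : Matrix (Fin d) (Fin d) F).IsTypeOf g ∧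
      ConjClasses.mk (π x) = c
  have hP : ∀ c ζ, act ζ (g c) ∈ D₀ ∧ P (act ζ (g c)) c := fun c ζ => by
    let y : SpecialLinearGroup (Fin d) F :=
      ⟨((ζ : Fˣ) : F) • (x c : Matrix (Fin d) (Fin d) F), by
        rw [Matrix.det_smul, (x c).det_coe, mul_one, Fintype.card_fin, ← Units.val_pow_eq_pow_val,
          hW ζ ζ.2, Units.val_one]⟩
    have hy : (y : Matrix (Fin d) (Fin d) F).IsTypeOf (act ζ (g c)) := (hg c).smul ζ
    refine ⟨(typeSet_finite (F := F) (d := d)).mem_toFinset.2 hy.mem_typeSet, y, hy, ?_⟩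
    rw [hπW ζ ζ.2 (x c) y rfl, hx]
  have h1 : Nat.card (ConjClasses H) * Nat.card W = ∑ c : ConjClasses H, ∑ ζ : W, 1 := by
    simp
  have h2 : ∀ c : ConjClasses H, ∑ ζ : W, 1 ≤
      ∑ g ∈ D₀, if P g c then (Finset.univ.filter fun ζ : W => act ζ g = g).card else 0 := by
    intro c
    rw [← Finset.card_eq_sum_ones, Finset.card_eq_sum_card_fiberwise
      (f := fun ζ => act ζ (g c)) (t := D₀) fun ζ _ => (hP c ζ).1]
    refine Finset.sum_le_sum fun g' hg' => ?_
    rcases (Finset.univ.filter fun ζ : W => act ζ (g c) = g').eq_empty_or_nonempty with h | ⟨ζ₀, h⟩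
    · rw [h]; simp
    · have hζ₀ := (Finset.mem_filter.1 h).2
      have hPg : P g' c := hζ₀ ▸ (hP c ζ₀).2
      rw [if_pos hPg]
      -- Translation by `ζ₀⁻¹` carries the scalars sending `g c` to `g'` into the stabilizer of
      -- `g'`.
      refine Finset.card_le_card_of_injOn (fun ζ => ζ₀⁻¹ * ζ) (fun ζ hζ => ?_) fun ζ _ ζ' _ h =>
        mul_left_cancel h
      have hζ' : act ζ (g c) = g' := (Finset.mem_filter.1 hζ).2
      refine Finset.mem_filter.2 ⟨Finset.mem_univ _, ?_⟩
      change act (ζ₀⁻¹ * ζ) g' = g'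
      conv_lhs => rw [← hζ₀, hact, mul_inv_cancel_left, hζ']
  rw [h1]
  refine (Finset.sum_le_sum fun c _ => h2 c).trans ?_
  rw [Finset.sum_comm]
  have h3 : ∀ g' ∈ D₀, ∑ c : ConjClasses H,
      (if P g' c then (Finset.univ.filter fun ζ : W => act ζ g' = g').card else 0) ≤
      ∑ ζ : W, if act ζ g' = g' then typeWeight g' else 0 := by
    intro g' _
    rw [← Finset.sum_filter, ← Finset.sum_filter, Finset.sum_const, Finset.sum_const, smul_eq_mul,
      smul_eq_mul, mul_comm]
    refine Nat.mul_le_mul_left _ ?_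
    have := card_conjClasses_isTypeOf_le π g'
    rwa [Nat.card_eq_fintype_card, Fintype.card_subtype] at this
  refine (Finset.sum_le_sum h3).trans (le_of_eq ?_)
  rw [Finset.sum_comm]
  exact Finset.sum_congr rfl fun ζ _ => (Finset.sum_filter _ _).symm

end ClassCount

/-! ### Numerical bounds for class numbers and for the group order -/

section Bounds

open Polynomial Matrix

universe u

variable {F : Type u} [Field F] [Fintype F] {d : ℕ} {H : Type*} [Group H]

theorem card_conjClasses_mul_card_le_aux (hd : 3 ≤ d) (hq : 11 ≤ Fintype.card F)
    (π : SpecialLinearGroup (Fin d) F →* H)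
    (hπ : Function.Surjective π) (W : Subgroup Fˣ) (hW : ∀ ζ ∈ W, ζ ^ d = 1)
    (hπW : ∀ ζ ∈ W, ∀ x y : SpecialLinearGroup (Fin d) F,
      (y : Matrix (Fin d) (Fin d) F) = (ζ : F) • (x : Matrix (Fin d) (Fin d) F) → π y = π x) :
    (Nat.card (ConjClasses H) : ℝ) * Nat.card W ≤
      (Fintype.card F : ℝ) ^ (d - 1) + 3 * (Fintype.card F : ℝ) ^ (d - 2) +
        ((Nat.card W : ℝ) - 1) * (2 * (Fintype.card F : ℝ) ^ (d / 2 - 1)) := by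
  classical
  have := Fintype.ofFinite W
  obtain ⟨D, hD, hcard⟩ := card_conjClasses_mul_card_le π hπ W hW hπW
  set q : ℝ := (Fintype.card F : ℝ) with hqdef
  have hq' : (11 : ℝ) ≤ q := by rw [hqdef]; exact_mod_cast hq
  have hcard' : (Nat.card (ConjClasses H) : ℝ) * Nat.card W ≤
      ∑ ζ : W, ∑ g ∈ D ζ, (typeWeight g : ℝ) := by exact_mod_cast hcard
  have h1 : q * ∑ g ∈ D 1, (typeWeight g : ℝ) ≤ q ^ d + 3 * q ^ (d - 1) := by
    obtain ⟨τ, hτ, hle⟩ := sum_typeWeight_le (by omega) (1 : Fˣ) (one_pow d) (D 1) (hD 1)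
    rw [orderOf_one, Nat.div_one] at hτ hle
    exact hle.trans (sum_shapes_sq_le_of_three_le d d hd q hq' τ hτ)
  have h2 : ∀ ζ : W, ζ ≠ 1 → q * ∑ g ∈ D ζ, (typeWeight g : ℝ) ≤ 2 * q ^ (d / 2) := by
    intro ζ hζ
    have hζd := hW ζ ζ.2
    obtain ⟨τ, hτ, hle⟩ := sum_typeWeight_le (by omega) (ζ : Fˣ) hζd (D ζ) (hD ζ)
    have ho : 2 ≤ orderOf (ζ : Fˣ) := by
      have h0 := orderOf_pos (ζ : Fˣ)
      have h1 : orderOf (ζ : Fˣ) ≠ 1 := fun h => hζ (Subtype.ext (orderOf_eq_one_iff.1 h))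
      omega
    have hdvd := orderOf_dvd_of_pow_eq_one hζd
    have hpos : 0 < d / orderOf (ζ : Fˣ) :=
      Nat.div_pos (Nat.le_of_dvd (by omega) hdvd) (by omega)
    refine (hle.trans (sum_shapes_sq_le_two_mul d _ hpos q hq' τ hτ)).trans ?_
    have : q ^ (d / orderOf (ζ : Fˣ)) ≤ q ^ (d / 2) :=
      pow_le_pow_right₀ (by linarith) (Nat.div_le_div_left ho (by norm_num))
    linarith
  have h3 : q * ∑ ζ : W, ∑ g ∈ D ζ, (typeWeight g : ℝ) ≤
      q ^ d + 3 * q ^ (d - 1) + ((Nat.card W : ℝ) - 1) * (2 * q ^ (d / 2)) := by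
    rw [Finset.mul_sum, ← Finset.add_sum_erase _ _ (Finset.mem_univ (1 : W))]
    refine add_le_add h1 ((Finset.sum_le_sum fun ζ hζ => h2 ζ (Finset.ne_of_mem_erase hζ)).trans ?_)
    rw [Finset.sum_const, Finset.card_erase_of_mem (Finset.mem_univ _), Finset.card_univ,
      nsmul_eq_mul, Nat.cast_sub Fintype.card_pos, Nat.card_eq_fintype_card, Nat.cast_one]
  have e1 : q ^ d = q * q ^ (d - 1) := by rw [← pow_succ']; congr 1; omega
  have e2 : q ^ (d - 1) = q * q ^ (d - 2) := by rw [← pow_succ']; congr 1; omega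
  have e3 : q ^ (d / 2) = q * q ^ (d / 2 - 1) := by rw [← pow_succ']; congr 1; omega
  refine hcard'.trans (le_of_mul_le_mul_left (h3.trans (le_of_eq ?_)) (by linarith : 0 < q))
  rw [e1, e3, e2]
  ring

theorem card_conjClasses_mul_card_le_five (hd : 3 ≤ d) (hq : 11 ≤ Fintype.card F)
    (π : SpecialLinearGroup (Fin d) F →* H)
    (hπ : Function.Surjective π) (W : Subgroup Fˣ) (hW : ∀ ζ ∈ W, ζ ^ d = 1)
    (hWd : Nat.card W ≤ d)
    (hπW : ∀ ζ ∈ W, ∀ x y : SpecialLinearGroup (Fin d) F,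
      (y : Matrix (Fin d) (Fin d) F) = (ζ : F) • (x : Matrix (Fin d) (Fin d) F) → π y = π x) :
    (Nat.card (ConjClasses H) : ℝ) * Nat.card W ≤
      (Fintype.card F : ℝ) ^ (d - 1) + 5 * (Fintype.card F : ℝ) ^ (d - 2) := by
  refine (card_conjClasses_mul_card_le_aux hd hq π hπ W hW hπW).trans ?_
  set q : ℝ := (Fintype.card F : ℝ) with hqdef
  have hq' : (11 : ℝ) ≤ q := by rw [hqdef]; exact_mod_cast hq
  have hWd' : (Nat.card W : ℝ) ≤ d := by exact_mod_cast hWd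
  -- Bernoulli: with `k = d - 1 - d / 2`, one has `|W| - 1 ≤ 2k + 1 ≤ 1 + k(q - 1) ≤ q^k`. The
  -- nontrivial scalars thus add at most `2 q^(d-2)`.
  have h1 : ((Nat.card W : ℝ) - 1) ≤ q ^ (d - 1 - d / 2) := by
    obtain ⟨k, hk⟩ : ∃ k, d - 1 - d / 2 = k := ⟨_, rfl⟩
    have h2 : (d : ℝ) ≤ 2 * k + 2 := by exact_mod_cast (by omega : d ≤ 2 * k + 2)
    have h3 := one_add_mul_le_pow (show (-2 : ℝ) ≤ q - 1 by linarith) k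
    rw [add_sub_cancel] at h3
    rw [hk]
    have : (0 : ℝ) ≤ k := Nat.cast_nonneg k
    nlinarith
  have h2 : q ^ (d - 2) = q ^ (d - 1 - d / 2) * q ^ (d / 2 - 1) := by
    rw [← pow_add]; congr 1; omega
  have h3 : 0 ≤ q ^ (d / 2 - 1) := by positivity
  have := mul_le_mul_of_nonneg_right h1 h3
  rw [← h2] at this
  linarith

theorem pow_add_mul_pow_le (hd : 3 ≤ d) {q c : ℝ} (hq : 11 ≤ q) (hc : 0 ≤ c) :
    q ^ (d - 1) + c * q ^ (d - 2) ≤ (11 + c) / 11 * q ^ (d - 1) := by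
  have e2 : q ^ (d - 1) = q * q ^ (d - 2) := by rw [← pow_succ']; congr 1; omega
  have : 0 < q ^ (d - 2) := pow_pos (by linarith) _
  have h := mul_le_mul_of_nonneg_right hq (mul_nonneg hc this.le)
  rw [e2]
  linarith

theorem card_specialLinearGroup_ge (hd : 0 < d) (hq : 11 ≤ Fintype.card F) :
    99 / 100 * (Fintype.card F : ℝ) ^ (d ^ 2 - 1) ≤
      (Nat.card (SpecialLinearGroup (Fin d) F) : ℝ) := by
  have h := SpecialLinearGroup.card_mul_eq (F := F) hd
  have h' := congrArg (fun n : ℕ => (n : ℝ)) h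
  simp only [Nat.cast_mul, Nat.cast_prod] at h'
  rw [Nat.cast_sub (by omega), Nat.cast_one] at h'
  set q : ℝ := (Fintype.card F : ℝ) with hqdef
  have hq' : (11 : ℝ) ≤ q := by rw [hqdef]; exact_mod_cast hq
  have hq0 : q ≠ 0 := by linarith
  have h1 : ∀ i : Fin d, ((Fintype.card F ^ d - Fintype.card F ^ (i : ℕ) : ℕ) : ℝ) =
      q ^ d * (1 - (q⁻¹) ^ (d - (i : ℕ))) := fun i => by
    rw [Nat.cast_sub (Nat.pow_le_pow_right (by omega) i.2.le), Nat.cast_pow, Nat.cast_pow, ← hqdef,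
      mul_sub, mul_one]
    congr 1
    have : q ^ d = q ^ (i : ℕ) * q ^ (d - (i : ℕ)) := by
      rw [← pow_add]; congr 1; omega
    rw [this, mul_assoc, ← mul_pow, mul_inv_cancel₀ hq0, one_pow, mul_one]
  rw [Finset.prod_congr rfl fun i _ => h1 i, Finset.prod_mul_distrib, Finset.prod_const,
    Finset.card_univ, Fintype.card_fin, ← pow_mul] at h'
  have h2 := div_le_prod_one_sub_inv_pow q (by linarith) (Finset.univ : Finset (Fin d))
    (fun i => d - (i : ℕ)) (fun i _ => by omega) (fun i _ j _ hij => Fin.ext (by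
      have := i.2
      have := j.2
      simp only at hij
      omega))
  have e1 : q ^ (d * d) = q * q ^ (d ^ 2 - 1) := by
    rw [← pow_succ', ← sq, Nat.sub_add_cancel (Nat.one_le_iff_ne_zero.2 (by positivity))]
  have hpos : 0 < q ^ (d ^ 2 - 1) := by positivity
  have h3 : q ^ (d * d) * ((q - 2) / (q - 1)) ≤
      (Nat.card (SpecialLinearGroup (Fin d) F) : ℝ) * (q - 1) := by
    rw [h']
    exact mul_le_mul_of_nonneg_left h2 (by positivity)
  -- Equality holds at `q = 11`, which is the source of `99/100`.
  have h4 : 99 / 100 * (q - 1) ≤ q * ((q - 2) / (q - 1)) := by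
    rw [← mul_div_assoc, le_div_iff₀ (by linarith)]
    nlinarith
  rw [e1] at h3
  have h5 := mul_le_mul_of_nonneg_right h4 hpos.le
  refine le_of_mul_le_mul_right ?_ (show 0 < q - 1 by linarith)
  linarith

end Bounds

/-! ### Character estimates and eigenvalue multiplicities -/

section EigenvalueMultiplicity

open Representation

variable {H : Type*} [Group H] [Finite H]

theorem Representation.norm_character_le_finrank {V : Type*} [AddCommGroup V] [Module ℂ V]
    [FiniteDimensional ℂ V] (ρ : Representation ℂ H V) (g : H) :
    ‖ρ.character g‖ ≤ Module.finrank ℂ V := by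
  classical
  let b := Module.finBasis ℂ V
  have h : ρ.character g = (LinearMap.charpoly (ρ g)).roots.sum := by
    rw [← LinearMap.charpoly_toMatrix (ρ g) b, ← Matrix.trace_eq_sum_roots_charpoly]
    exact LinearMap.trace_eq_matrix_trace ℂ b (ρ g)
  rw [h]
  refine (Multiset.le_sum_of_subadditive (fun z : ℂ => ‖z‖) norm_zero.le norm_add_le _).trans ?_
  rw [← LinearMap.charpoly_natDegree (ρ g), ← IsAlgClosed.card_roots_eq_natDegree]
  refine (Multiset.sum_le_card_nsmul _ 1 fun x hx => ?_).trans (by simp)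
  obtain ⟨μ, hμ, rfl⟩ := Multiset.mem_map.1 hx
  refine (finrank_eigenspace_eq ρ g μ ?_).1.le
  rw [Module.End.hasEigenvalue_iff_isRoot_charpoly]
  exact Polynomial.isRoot_of_mem_roots hμ

theorem Representation.norm_character_le_rpow_mul {V : Type*} [AddCommGroup V] [Module ℂ V]
    [FiniteDimensional ℂ V] (ρ : Representation ℂ H V) [ρ.IsIrreducible] {q : ℕ} (hq : 0 < q)
    {k : ℕ} {a : ℝ} (x : H)
    (hx : Nat.card (Subgroup.centralizer ({x} : Set H)) ≤ q ^ k)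
    (hn : (q : ℝ) ^ (a / 2) ≤ Module.finrank ℂ V) :
    ‖ρ.character x‖ ≤ (q : ℝ) ^ ((k - a) / 2) * Module.finrank ℂ V := by
  have hq' : (0 : ℝ) < q := by exact_mod_cast hq
  have h1 : ‖ρ.character x‖ ^ 2 ≤ ((q : ℝ) ^ ((k : ℝ) / 2)) ^ 2 := by
    refine (ρ.norm_sq_character_le_card_centralizer x).trans ?_
    rw [← Real.rpow_natCast ((q : ℝ) ^ ((k : ℝ) / 2)) 2, ← Real.rpow_mul hq'.le, Nat.cast_ofNat,
      div_mul_cancel₀ _ two_ne_zero, Real.rpow_natCast]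
    exact_mod_cast hx
  refine (abs_le_of_sq_le_sq' h1 (by positivity)).2.trans ?_
  have h2 : (q : ℝ) ^ ((k : ℝ) / 2) = (q : ℝ) ^ ((k - a) / 2) * (q : ℝ) ^ (a / 2) := by
    rw [← Real.rpow_add hq']
    ring_nf
  rw [h2]
  exact mul_le_mul_of_nonneg_left hn (by positivity)

theorem card_filter_range_orderOf_pow_le (g : H) (P : H → Prop) [DecidablePred P] :
    ((Finset.range (orderOf g)).filter fun i => P (g ^ i)).card ≤
      Nat.card {y : Subgroup.zpowers g // P y} := by
  classical
  rw [← Nat.card_eq_finsetCard]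
  refine Nat.card_le_card_of_injective
    (fun i => (⟨⟨g ^ (i : ℕ), ⟨(i : ℕ), zpow_natCast g i⟩⟩, (Finset.mem_filter.1 i.2).2⟩ :
      {y : Subgroup.zpowers g // P y})) fun i j hij => ?_
  have h : g ^ (i : ℕ) = g ^ (j : ℕ) := 
    congrArg (fun y : {y : Subgroup.zpowers g // P y} => (y.1 : H)) hij
  exact Subtype.ext (pow_injOn_Iio_orderOf (Finset.mem_range.1 (Finset.mem_filter.1 i.2).1)
    (Finset.mem_range.1 (Finset.mem_filter.1 j.2).1) h)

theorem card_filter_range_orderOf_mem_le (g : H) (Z : Subgroup H) [DecidablePred (· ∈ Z)] :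
    ((Finset.range (orderOf g)).filter fun i => g ^ i ∈ Z).card ≤ Nat.card Z :=
  (card_filter_range_orderOf_pow_le g (· ∈ Z)).trans <|
    Nat.card_le_card_of_injective (fun y => (⟨y.1, y.2⟩ : Z)) fun _ _ hyz =>
      Subtype.ext (Subtype.ext (congrArg (fun w : Z => (w : H)) hyz))

/-- In a cyclic group at most `k` elements satisfy `y^k = 1`; sum over `k < m`. -/
theorem card_filter_range_orderOf_lt_le (g : H) (m : ℕ) :
    ((Finset.range (orderOf g)).filter fun i => orderOf (g ^ i) < m).card ≤ m * m := by
  classical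
  have := Fintype.ofFinite (Subgroup.zpowers g)
  refine (card_filter_range_orderOf_pow_le g (orderOf · < m)).trans ?_
  rw [Nat.card_eq_fintype_card, Fintype.card_subtype]
  have h : (Finset.univ.filter fun y : Subgroup.zpowers g => orderOf (y : H) < m) ⊆
      (Finset.range m).biUnion fun k => if 0 < k then
        Finset.univ.filter fun y : Subgroup.zpowers g => y ^ k = 1 else ∅ := by
    intro y hy
    rw [Finset.mem_filter, Subgroup.orderOf_coe] at hy
    refine Finset.mem_biUnion.2 ⟨orderOf y, Finset.mem_range.2 hy.2, ?_⟩
    rw [if_pos (orderOf_pos y)]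
    simp [pow_orderOf_eq_one]
  refine (Finset.card_le_card h).trans ((Finset.card_biUnion_le_card_mul _ _ m ?_).trans
    (by rw [Finset.card_range]))
  intro k hk
  split_ifs with hk0
  · exact (IsCyclic.card_pow_eq_one_le hk0).trans (Finset.mem_range.1 hk).le
  · simp

theorem Representation.finrank_eigenspace_mul_orderOf_le {V : Type*} [AddCommGroup V] [Module ℂ V]
    [FiniteDimensional ℂ V] (ρ : Representation ℂ H V) [ρ.IsIrreducible] {d q : ℕ} (hd : 11 ≤ d)
    (hq : 0 < q)
    (hn : (q : ℝ) ^ (((d : ℝ) ^ 2 - d - 1) / 2) ≤ Module.finrank ℂ V)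
    (hnc : ∀ x : H, x ∉ Subgroup.center H →
      Nat.card (Subgroup.centralizer ({x} : Set H)) ≤ q ^ (d ^ 2 + 2 - 2 * d))
    (hord : ∀ x : H, orderOf x < q ^ d)
    (hc : ∀ x : H, Nat.card (Subgroup.centralizer ({x} : Set H)) ≤ q ^ (d ^ 2 + 8 - 4 * d) ∨
      orderOf x < q ^ 2)
    (g : H) (μ : ℂ) (hμ : Module.End.HasEigenvalue (ρ g) μ) :
    (Module.finrank ℂ (Module.End.eigenspace (ρ g) μ) : ℝ) * orderOf g ≤
      ((Nat.card (Subgroup.center H) : ℝ) + 2) * Module.finrank ℂ V := by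
  classical
  have hq1 : (1 : ℝ) ≤ q := by exact_mod_cast hq
  have hq0 : (0 : ℝ) < q := by linarith
  set n : ℝ := (Module.finrank ℂ V : ℝ) with hndef
  have hn0 : 0 ≤ n := Nat.cast_nonneg _
  obtain ⟨hμ1, hmult⟩ := finrank_eigenspace_eq ρ g μ hμ
  have hN : (orderOf g : ℂ) ≠ 0 := by exact_mod_cast (orderOf_pos g).ne'
  have h1 : (Module.finrank ℂ (Module.End.eigenspace (ρ g) μ) : ℝ) * orderOf g ≤
      ∑ i ∈ Finset.range (orderOf g), ‖ρ.character (g ^ i)‖ := by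
    have : ((Module.finrank ℂ (Module.End.eigenspace (ρ g) μ) : ℂ) * orderOf g) =
        ∑ i ∈ Finset.range (orderOf g), (μ⁻¹) ^ i * ρ.character (g ^ i) := by
      rw [hmult, mul_comm, mul_inv_cancel_left₀ hN]
    have h := congrArg (fun z : ℂ => ‖z‖) this
    rw [norm_mul, Complex.norm_natCast, Complex.norm_natCast] at h
    rw [h]
    refine (norm_sum_le _ _).trans (le_of_eq (Finset.sum_congr rfl fun i _ => ?_))
    rw [norm_mul, norm_pow, norm_inv, hμ1, inv_one, one_pow, one_mul]
  set a : ℝ := (q : ℝ) ^ ((3 - (d : ℝ)) / 2) with ha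
  set b : ℝ := (q : ℝ) ^ ((9 - 3 * (d : ℝ)) / 2) with hb
  have ha0 : 0 ≤ a := by positivity
  have hb0 : 0 ≤ b := by positivity
  -- Central elements, noncentral ones of order below `q^2`, and the rest, which have small
  -- centralizers; adding all applicable bounds avoids a partition of the powers of `g`.
  have h2 : ∀ x : H, ‖ρ.character x‖ ≤ (if x ∈ Subgroup.center H then n else 0) +
      (if orderOf x < q ^ 2 then a * n else 0) + b * n := by
    intro x
    have hbn : 0 ≤ b * n := mul_nonneg hb0 hn0
    have han : 0 ≤ a * n := mul_nonneg ha0 hn0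
    by_cases hx : x ∈ Subgroup.center H
    · have := ρ.norm_character_le_finrank x
      rw [if_pos hx]
      split_ifs <;> linarith
    rw [if_neg hx]
    by_cases hx2 : orderOf x < q ^ 2
    · have := ρ.norm_character_le_rpow_mul hq x (hnc x hx) hn
      rw [Nat.cast_sub (by nlinarith)] at this
      push_cast at this
      rw [show ((d : ℝ) ^ 2 + 2 - 2 * d - (d ^ 2 - d - 1)) / 2 = (3 - d) / 2 by ring] at this
      rw [if_pos hx2]
      linarith
    · have := ρ.norm_character_le_rpow_mul hq x ((hc x).resolve_right hx2) hn
      rw [Nat.cast_sub (by nlinarith)] at this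
      push_cast at this
      rw [show ((d : ℝ) ^ 2 + 8 - 4 * d - (d ^ 2 - d - 1)) / 2 = (9 - 3 * d) / 2 by ring] at this
      rw [if_neg hx2]
      linarith
  refine h1.trans ((Finset.sum_le_sum fun i _ => h2 (g ^ i)).trans ?_)
  rw [Finset.sum_add_distrib, Finset.sum_add_distrib, ← Finset.sum_filter, ← Finset.sum_filter,
    Finset.sum_const, Finset.sum_const, Finset.sum_const, nsmul_eq_mul, nsmul_eq_mul, nsmul_eq_mul,
    Finset.card_range]
  have hd' : (11 : ℝ) ≤ d := by exact_mod_cast hd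
  have c1 : (((Finset.range (orderOf g)).filter fun i => g ^ i ∈ Subgroup.center H).card : ℝ) ≤
      Nat.card (Subgroup.center H) := by
    exact_mod_cast card_filter_range_orderOf_mem_le g (Subgroup.center H)
  -- At most `q^4` powers of `g` have order below `q^2`, and `4 + (3 - d)/2 ≤ 0` amounts to `d ≥
  -- 11`. In the next estimate the exponent is `d + (9 - 3d)/2 = (9 - d)/2`.
  have c2 : (((Finset.range (orderOf g)).filter fun i => orderOf (g ^ i) < q ^ 2).card : ℝ) * a ≤
      1 := by
    have h : (((Finset.range (orderOf g)).filter fun i => orderOf (g ^ i) < q ^ 2).card : ℝ) ≤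
        (q : ℝ) ^ (4 : ℝ) := by
      have := card_filter_range_orderOf_lt_le g (q ^ 2)
      rw [← pow_add] at this
      exact_mod_cast this
    refine (mul_le_mul_of_nonneg_right h ha0).trans ?_
    rw [ha, ← Real.rpow_add hq0]
    exact Real.rpow_le_one_of_one_le_of_nonpos hq1 (by linarith)
  have c3 : (orderOf g : ℝ) * b ≤ 1 := by
    have h : (orderOf g : ℝ) ≤ (q : ℝ) ^ (d : ℝ) := by
      rw [Real.rpow_natCast]
      exact_mod_cast (hord g).le
    refine (mul_le_mul_of_nonneg_right h hb0).trans ?_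
    rw [hb, ← Real.rpow_add hq0]
    exact Real.rpow_le_one_of_one_le_of_nonpos hq1 (by linarith)
  have := mul_le_mul_of_nonneg_right (add_le_add (add_le_add c1 c2) c3) hn0
  linarith

theorem IrrChar.finsum_charDegree_sq_le (s : ℝ) :
    ∑ᶠ χ ∈ {χ ∈ IrrChar H | charDegree χ < s}, charDegree χ ^ 2 ≤
      Nat.card (ConjClasses H) * s ^ 2 := by
  classical
  obtain ⟨hfin, hle⟩ := irrChar_finite_and_ncard_le (H := H)
  have hsub : {χ ∈ IrrChar H | charDegree χ < s} ⊆ IrrChar H := fun χ hχ => hχ.1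
  have hfin' := hfin.subset hsub
  rw [finsum_mem_eq_finite_toFinset_sum _ hfin']
  refine (Finset.sum_le_card_nsmul _ _ (s ^ 2) fun χ hχ => ?_).trans ?_
  · obtain ⟨⟨n, ρ, -, rfl⟩, h⟩ := (hfin'.mem_toFinset).1 hχ
    rw [charDegree_character] at h ⊢
    exact pow_le_pow_left₀ (Nat.cast_nonneg _) h.le 2
  · rw [nsmul_eq_mul, ← Set.ncard_eq_toFinset_card _ hfin']
    refine mul_le_mul_of_nonneg_right ?_ (sq_nonneg s)
    exact_mod_cast (Set.ncard_le_ncard hsub hfin).trans hle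

end EigenvalueMultiplicity

/-! ### Uniform treatment of `SL` and `PSL`, and assembly -/

section QuotientsOfSpecialLinear

open Matrix

variable {F : Type*} [Field F] [Fintype F] {d : ℕ} {H : Type*} [Group H]

theorem MonoidHom.card_mul_card_ker {G : Type*} [Group G] (π : G →* H)
    (hπ : Function.Surjective π) : Nat.card H * Nat.card π.ker = Nat.card G := by
  rw [← Subgroup.card_mul_index π.ker, Subgroup.index_ker, MonoidHom.range_eq_top.2 hπ,
    Nat.card_congr Subgroup.topEquiv.toEquiv, mul_comm]

theorem IrrChar.finsum_charDegree_sq_lt (hd : 3 ≤ d) (hq : 11 ≤ Fintype.card F)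
    (π : SpecialLinearGroup (Fin d) F →* H) (hπ : Function.Surjective π)
    (hk : (Nat.card (ConjClasses H) : ℝ) * Nat.card π.ker ≤
      16 / 11 * (Fintype.card F : ℝ) ^ (d - 1)) :
    ∑ᶠ χ ∈ {χ ∈ IrrChar H |
        charDegree χ < (Fintype.card F : ℝ) ^ (((d : ℝ) ^ 2 - (d : ℝ) - 1) / 2)},
          charDegree χ ^ 2 <
      5 / (3 * (Fintype.card F : ℝ)) * (Nat.card H : ℝ) := by
  have : Finite H := Finite.of_surjective π hπ
  have hG := card_specialLinearGroup_ge (F := F) (d := d) (by omega) hq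
  have hcard := congrArg (fun n : ℕ => (n : ℝ)) (π.card_mul_card_ker hπ)
  simp only [Nat.cast_mul] at hcard
  have hle := IrrChar.finsum_charDegree_sq_le (H := H)
    ((Fintype.card F : ℝ) ^ (((d : ℝ) ^ 2 - (d : ℝ) - 1) / 2))
  set q : ℝ := (Fintype.card F : ℝ) with hqdef
  have hq' : (11 : ℝ) ≤ q := by rw [hqdef]; exact_mod_cast hq
  have hq0 : 0 < q := by linarith
  set s : ℝ := q ^ (((d : ℝ) ^ 2 - (d : ℝ) - 1) / 2) with hs
  have hY : q * (q ^ (d - 1) * s ^ 2) = q ^ (d ^ 2 - 1) := by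
    have h1 : s ^ 2 = q ^ ((d : ℝ) ^ 2 - d - 1) := by
      rw [hs, ← Real.rpow_natCast, ← Real.rpow_mul hq0.le, Nat.cast_ofNat,
        div_mul_cancel₀ _ two_ne_zero]
    rw [h1, ← mul_assoc, ← pow_succ', Nat.sub_add_cancel (by omega), ← Real.rpow_natCast q d,
      ← Real.rpow_natCast q (d ^ 2 - 1), ← Real.rpow_add hq0,
      Nat.cast_sub (Nat.one_le_pow _ _ (by omega))]
    push_cast
    ring_nf
  set Y : ℝ := q ^ (d - 1) * s ^ 2 with hYdef
  have hY0 : 0 < Y := by positivity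
  have he : (0 : ℝ) < Nat.card π.ker := by exact_mod_cast Nat.card_pos
  refine lt_of_mul_lt_mul_right ?_ he.le
  have h1 := mul_le_mul_of_nonneg_right hle he.le
  have h2 := mul_le_mul_of_nonneg_right hk (sq_nonneg s)
  have h3 : 5 / (3 * q) * (99 / 100 * (q * Y)) ≤ 5 / (3 * q) * (Nat.card H * Nat.card π.ker) := by
    rw [hcard, hY]
    exact mul_le_mul_of_nonneg_left hG (by positivity)
  -- The strict inequality rests on `16/11 < 33/20 = (5/3)(99/100)`.
  have h4 : 5 / (3 * q) * (99 / 100 * (q * Y)) = 33 / 20 * Y := by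
    field_simp
    norm_num
  rw [h4] at h3
  calc _ ≤ _ := h1
    _ = (Nat.card (ConjClasses H) : ℝ) * Nat.card π.ker * s ^ 2 := by ring
    _ ≤ _ := h2
    _ = 16 / 11 * Y := by rw [hYdef]; ring
    _ < 33 / 20 * Y := by linarith
    _ ≤ _ := h3
    _ = _ := by ring

theorem MonoidHom.card_centralizer_le_of_notMem_center
    (π : SpecialLinearGroup (Fin d) F →* H) (hπ : Function.Surjective π)
    (hker : π.ker ≤ Subgroup.center _) (x : H) (hx : x ∉ Subgroup.center H) :
    Nat.card (Subgroup.centralizer ({x} : Set H)) ≤ Fintype.card F ^ (d ^ 2 + 2 - 2 * d) := by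
  obtain ⟨y, rfl⟩ := hπ x
  exact (π.card_centralizer_map_le hπ hker y).trans
    (y.card_centralizer_le_of_notMem_center (π.notMem_center_of_map_notMem_center hπ y hx))

theorem MonoidHom.orderOf_lt_card_pow (hd : 0 < d)
    (π : SpecialLinearGroup (Fin d) F →* H) (hπ : Function.Surjective π) (x : H) :
    orderOf x < Fintype.card F ^ d := by
  obtain ⟨y, rfl⟩ := hπ x
  exact (Nat.le_of_dvd (orderOf_pos y) (orderOf_map_dvd π y)).trans_lt (y.orderOf_lt hd)

theorem MonoidHom.card_centralizer_le_or_orderOf_lt (hd : 2 ≤ d)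
    (π : SpecialLinearGroup (Fin d) F →* H) (hπ : Function.Surjective π)
    (hker : π.ker ≤ Subgroup.center _) (x : H) :
    Nat.card (Subgroup.centralizer ({x} : Set H)) ≤ Fintype.card F ^ (d ^ 2 + 8 - 4 * d) ∨
      orderOf x < Fintype.card F ^ 2 := by
  obtain ⟨y, rfl⟩ := hπ x
  refine (y.card_centralizer_le_or_orderOf_lt hd).imp (π.card_centralizer_map_le hπ hker y).trans
    (Nat.le_of_dvd (orderOf_pos y) (orderOf_map_dvd π y)).trans_lt

theorem card_conjClasses_le_of_specialLinear (hd : 3 ≤ d) (hq : 11 ≤ Fintype.card F)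
    (e : H ≃* SpecialLinearGroup (Fin d) F) :
    (Nat.card (ConjClasses H) : ℝ) ≤
      (Fintype.card F : ℝ) ^ (d - 1) + 3 * (Fintype.card F : ℝ) ^ (d - 2) := by
  have h := card_conjClasses_mul_card_le_aux hd hq e.symm.toMonoidHom e.symm.surjective ⊥
    (fun ζ hζ => by rw [Subgroup.mem_bot.1 hζ, one_pow])
    (fun ζ hζ x y hxy => by
      rw [Subgroup.mem_bot.1 hζ, Units.val_one, one_smul] at hxy
      rw [Subtype.ext hxy])
  simpa using h

/-- Takes `W` to be all `d`-th roots of unity: the corresponding scalar matrices are central, so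
they become trivial in the quotient. -/
theorem card_conjClasses_mul_gcd_le_of_projectiveSpecialLinear (hd : 3 ≤ d)
    (hq : 11 ≤ Fintype.card F) (e : H ≃* ProjectiveSpecialLinearGroup (Fin d) F) :
    (Nat.card (ConjClasses H) : ℝ) * Nat.gcd d (Fintype.card F - 1) ≤
      (Fintype.card F : ℝ) ^ (d - 1) + 5 * (Fintype.card F : ℝ) ^ (d - 2) := by
  have h := card_conjClasses_mul_card_le_five hd hq
    (e.symm.toMonoidHom.comp (QuotientGroup.mk' (Subgroup.center _)))
    (e.symm.surjective.comp (QuotientGroup.mk'_surjective _)) (rootsOfUnity d F)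
    (fun ζ hζ => (mem_rootsOfUnity d ζ).1 hζ)
    (by rw [card_rootsOfUnity_eq_gcd]; exact Nat.gcd_le_left _ (by omega))
    (fun ζ hζ x y hxy => by
      refine congrArg e.symm (Eq.symm (QuotientGroup.eq.2 ?_))
      refine Matrix.SpecialLinearGroup.mem_center_iff.2 ⟨(ζ : F), ?_, ?_⟩
      · rw [Fintype.card_fin, ← Units.val_pow_eq_pow_val, (mem_rootsOfUnity d ζ).1 hζ,
          Units.val_one]
      · rw [Matrix.SpecialLinearGroup.coe_mul, hxy, Matrix.mul_smul, ← Matrix.SpecialLinearGroup.coe_mul,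
          inv_mul_cancel, Matrix.SpecialLinearGroup.coe_one, smul_one_eq_diagonal, scalar_apply])
  rwa [card_rootsOfUnity_eq_gcd] at h

theorem exists_surjective_of_specialLinear_or_projective (hd : 3 ≤ d) (hq : 11 ≤ Fintype.card F)
    (hH : Nonempty (H ≃* SpecialLinearGroup (Fin d) F) ∨
      Nonempty (H ≃* ProjectiveSpecialLinearGroup (Fin d) F)) :
    ∃ π : SpecialLinearGroup (Fin d) F →* H, Function.Surjective π ∧
      π.ker ≤ Subgroup.center _ ∧
      (Nat.card (ConjClasses H) : ℝ) * Nat.card π.ker ≤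
        16 / 11 * (Fintype.card F : ℝ) ^ (d - 1) := by
  have hq' : (11 : ℝ) ≤ (Fintype.card F : ℝ) := by exact_mod_cast hq
  obtain ⟨⟨e⟩⟩ | ⟨⟨e⟩⟩ := hH
  · have hker : e.symm.toMonoidHom.ker = ⊥ :=
      (MonoidHom.ker_eq_bot_iff _).2 e.symm.injective
    refine ⟨e.symm.toMonoidHom, e.symm.surjective, by rw [hker]; exact bot_le, ?_⟩
    rw [hker, Subgroup.card_bot, Nat.cast_one, mul_one]
    have h1 := pow_add_mul_pow_le hd hq' (show (0 : ℝ) ≤ 3 by norm_num)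
    have h2 : 0 < (Fintype.card F : ℝ) ^ (d - 1) := by positivity
    refine (card_conjClasses_le_of_specialLinear hd hq e).trans (h1.trans ?_)
    exact mul_le_mul_of_nonneg_right (by norm_num) h2.le
  · let π := e.symm.toMonoidHom.comp
      (QuotientGroup.mk' (Subgroup.center (SpecialLinearGroup (Fin d) F)))
    have hker : π.ker = Subgroup.center _ := by
      rw [MonoidHom.ker_comp_of_injective _ _ e.symm.injective, QuotientGroup.ker_mk']
    refine ⟨π, e.symm.surjective.comp (QuotientGroup.mk'_surjective _), hker.le, ?_⟩
    rw [hker, Matrix.SpecialLinearGroup.card_center (by omega)]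
    refine (card_conjClasses_mul_gcd_le_of_projectiveSpecialLinear hd hq e).trans
      ((pow_add_mul_pow_le hd hq' (show (0 : ℝ) ≤ 5 by norm_num)).trans (le_of_eq ?_))
    norm_num

end QuotientsOfSpecialLinear

theorem proposition3p3 :
    -- `K` quantifies the phrase "`p` or `d` is sufficiently large" in part (iv)
    ∃ K : ℕ, ∀ (d q : ℕ), 3 ≤ d → 11 ≤ q →
    ∀ (F : Type*) [Field F] [Fintype F], Fintype.card F = q →
    ∀ (H : Type*) [Group H],
      (Nonempty (H ≃* Matrix.SpecialLinearGroup (Fin d) F) ∨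
        Nonempty (H ≃* Matrix.ProjectiveSpecialLinearGroup (Fin d) F)) →
    -- the order `e_H` of the centre: `e_G = e := gcd(d, q - 1)` and `e_S = 1`
    ((Nonempty (H ≃* Matrix.SpecialLinearGroup (Fin d) F) →
        Nat.card (Subgroup.center H) = Nat.gcd d (q - 1)) ∧
      (Nonempty (H ≃* Matrix.ProjectiveSpecialLinearGroup (Fin d) F) →
        Nat.card (Subgroup.center H) = 1)) ∧
    -- (i)
    ((IrrChar H).Finite ∧
      (Nonempty (H ≃* Matrix.SpecialLinearGroup (Fin d) F) →
        ((IrrChar H).ncard : ℝ) ≤ (q : ℝ) ^ (d - 1) + 3 * (q : ℝ) ^ (d - 2) ∧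
        (q : ℝ) ^ (d - 1) + 3 * (q : ℝ) ^ (d - 2) ≤ 14 / 11 * (q : ℝ) ^ (d - 1)) ∧
      (Nonempty (H ≃* Matrix.ProjectiveSpecialLinearGroup (Fin d) F) →
        ((IrrChar H).ncard : ℝ) ≤
          ((q : ℝ) ^ (d - 1) + 5 * (q : ℝ) ^ (d - 2)) / (Nat.gcd d (q - 1) : ℝ) ∧
        ((q : ℝ) ^ (d - 1) + 5 * (q : ℝ) ^ (d - 2)) / (Nat.gcd d (q - 1) : ℝ) ≤
          16 / (11 * (Nat.gcd d (q - 1) : ℝ)) * (q : ℝ) ^ (d - 1)) ∧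
      (∑ᶠ χ ∈ {χ ∈ IrrChar H |
          charDegree χ < (q : ℝ) ^ (((d : ℝ) ^ 2 - (d : ℝ) - 1) / 2)}, charDegree χ ^ 2) <
        5 / (3 * (q : ℝ)) * (Nat.card H : ℝ)) ∧
    -- (ii)
    (∀ χ ∈ IrrChar H, (q : ℝ) ^ (((d : ℝ) ^ 2 - (d : ℝ) - 1) / 2) ≤ charDegree χ →
      ∀ x : H, x ∉ Subgroup.center H →
        ‖χ x‖ / charDegree χ ≤ (q : ℝ) ^ ((3 - (d : ℝ)) / 2)) ∧
    -- (iii); note that `d ^ 2 + 8 - 4 * d` is `d² - 4d + 8` without truncation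
    (∀ p f : ℕ, p.Prime → q = p ^ f → d ≤ p → ∀ x : H,
      orderOf x < q ^ (d + 1) ∧
      (Nat.card (Subgroup.centralizer ({x} : Set H)) ≤ q ^ (d ^ 2 + 8 - 4 * d) ∨
        orderOf x < q ^ 2)) ∧
    -- (iv)
    (43 ≤ d → q.Prime → d ≤ q → (K ≤ q ∨ K ≤ d) →
      ∀ g : H, g ≠ 1 →
      ∀ (V : Type*) [AddCommGroup V] [Module ℂ V] [FiniteDimensional ℂ V]
        (Φ : Representation ℂ H V), Φ.IsIrreducible →
        (q : ℝ) ^ (((d : ℝ) ^ 2 - (d : ℝ) - 1) / 2) ≤ (Module.finrank ℂ V : ℝ) →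
        ∀ μ : ℂ, Module.End.HasEigenvalue (Φ g) μ →
          (Module.finrank ℂ (Module.End.eigenspace (Φ g) μ) : ℝ) ≤
            ((Nat.card (Subgroup.center H) : ℝ) + 2) * (Module.finrank ℂ V : ℝ) /
              (orderOf g : ℝ)) := by
  -- The estimate behind (iv) already closes for `d ≥ 11`, so `K = 0` works.
  refine ⟨0, ?_⟩
  intro d q hd hq F _ _ hFq H _ hH
  subst hFq
  have hq' : (11 : ℝ) ≤ (Fintype.card F : ℝ) := by exact_mod_cast hq
  have hq0 : 0 < Fintype.card F := by omega
  obtain ⟨π, hπ, hker, hk⟩ := exists_surjective_of_specialLinear_or_projective hd hq hH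
  have : Finite H := Finite.of_surjective π hπ
  obtain ⟨hfin, hncard⟩ := irrChar_finite_and_ncard_le (H := H)
  have hncard' : ((IrrChar H).ncard : ℝ) ≤ Nat.card (ConjClasses H) := by exact_mod_cast hncard
  have hgcd : (0 : ℝ) < (Nat.gcd d (Fintype.card F - 1) : ℝ) := by
    exact_mod_cast Nat.gcd_pos_of_pos_left _ (by omega)
  refine ⟨⟨?_, ?_⟩, ⟨hfin, ?_, ?_, ?_⟩, ?_, ?_, ?_⟩
  · rintro ⟨e⟩
    rw [Nat.card_congr (Subgroup.centerCongr e).toEquiv,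
      Matrix.SpecialLinearGroup.card_center (by omega)]
  · rintro ⟨e⟩
    rw [Nat.card_congr (Subgroup.centerCongr e).toEquiv,
      Matrix.ProjectiveSpecialLinearGroup.center_eq_bot hd, Subgroup.card_bot]
  · rintro ⟨e⟩
    refine ⟨hncard'.trans (card_conjClasses_le_of_specialLinear hd hq e), ?_⟩
    refine (pow_add_mul_pow_le hd hq' (by norm_num)).trans (le_of_eq ?_)
    norm_num
  · rintro ⟨e⟩
    constructor
    · rw [le_div_iff₀ hgcd]
      exact (mul_le_mul_of_nonneg_right hncard' hgcd.le).trans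
        (card_conjClasses_mul_gcd_le_of_projectiveSpecialLinear hd hq e)
    · rw [div_le_iff₀ hgcd]
      refine (pow_add_mul_pow_le hd hq' (by norm_num)).trans (le_of_eq ?_)
      field_simp
      norm_num
  · exact IrrChar.finsum_charDegree_sq_lt hd hq π hπ hk
  · rintro χ ⟨n, ρ, hρ, rfl⟩ hχ x hx
    rw [charDegree_character] at hχ ⊢
    have h := ρ.norm_character_le_rpow_mul hq0 x
      (π.card_centralizer_le_of_notMem_center hπ hker x hx)
      (a := (d : ℝ) ^ 2 - d - 1) (by rwa [Module.finrank_fin_fun])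
    rw [Module.finrank_fin_fun, Nat.cast_sub (by nlinarith)] at h
    push_cast at h
    rw [show ((d : ℝ) ^ 2 + 2 - 2 * d - (d ^ 2 - d - 1)) / 2 = (3 - d) / 2 by ring] at h
    exact div_le_of_le_mul₀ (Nat.cast_nonneg n) (by positivity) h
  · intro p f _ _ _ x
    exact ⟨(π.orderOf_lt_card_pow (by omega) hπ x).trans_le
      (Nat.pow_le_pow_right hq0 (Nat.le_succ d)),
      π.card_centralizer_le_or_orderOf_lt (by omega) hπ hker x⟩
  · intro hd' _ _ _ g _ V _ _ _ Φ hΦ hn μ hμ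
    rw [le_div_iff₀ (by exact_mod_cast orderOf_pos g)]
    exact Φ.finrank_eigenspace_mul_orderOf_le (by omega) hq0 hn
      (π.card_centralizer_le_of_notMem_center hπ hker)
      (π.orderOf_lt_card_pow (by omega) hπ)
      (π.card_centralizer_le_or_orderOf_lt (by omega) hπ hker) g μ hμ
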